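/- Let $\pi$ be a set of primes. Write $m\in\pi'$ if $m$ is a positive integer none of whose prime divisors lies in $\pi$. A group is *$\pi$-local* if $x\mapsto x^q$ is bijective on it for every prime $q\notin\pi$. A *$\pi$-localization* of a group $G$ is a homomorphism $G\to G_\pi$ to a $\pi$-local group through which every homomorphism from $G$ to a $\pi$-local group factors uniquely. Let $\mathbb Z_\pi$ be the additive group of the rationals with denominator in $\pi'$. The class $\mathcal P_\pi$ consists of the groups $G$ such that (i) $x\mapsto x^m$ is injective on $G$ for every $m\in\pi'$; and (ii) whenever $x\in G$ has no $m$-th root in $G$ for some $m\in\pi'$, and $D_G(x)=\{g\in G : C_G(x)\cap g^{-1}C_G(x)g\neq 1\}$, then $C_G(x)$ is torsion-free and either (a) $D_G(x)=C_G(x)$, or (b) $D_G(x)$ is a subgroup, $|D_G(x):C_G(x)|=2$ and $C_G(x)$ is isomorphic to a subgroup of $\mathbb Z_\pi$. **Theorem.** Let $\pi$ be a finite set of primes, let $G$ be a finitely generated metabelian group (that is, $G''=1$), and let $G\to G_\pi$ be its $\pi$-localization. Then 1. either $G$ has a normal subgroup $N$ such that $G/N$ lies in $\mathcal P_\pi$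 and is not $\pi$-local, and $G_\pi$ is not soluble; or $G_\pi$ is virtually nilpotent; 2. if $G$ has a normal subgroup $N$ such that $G/N$ lies in $\mathcal P_\pi$ and is not virtually nilpotent, then $G_\pi$ is not soluble. -/

import Mathlib

universe u v

namespace PiGroup

/-- `m` is a positive integer all of whose prime divisors lie outside `π`; in symbols, `m ∈ π'`. -/
def IsPrimeTo (π : Set ℕ) (m : ℕ) : Prop :=
  0 < m ∧ ∀ p : ℕ, p.Prime → p ∣ m → p ∉ π

/-- A group is `π`-local if `x ↦ x ^ q` is bijective for every prime `q ∉ π`. -/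
def IsLocal (π : Set ℕ) (G : Type u) [Group G] : Prop :=
  ∀ q : ℕ, q.Prime → q ∉ π → Function.Bijective fun x : G => x ^ q

/-- The homomorphism `l : G → L` is a `π`-localization of `G`: the group `L` is `π`-local, and every
homomorphism from `G` to a `π`-local group factors uniquely through `l`. -/
structure IsLocalization (π : Set ℕ) {G L : Type u} [Group G] [Group L] (l : G →* L) : Prop where
  isLocal : IsLocal π L
  existsUnique_lift : ∀ (H : Type u) [Group H], IsLocal π H → ∀ θ : G →* H,
    ∃! θ' : L →* H, θ'.comp l = θ

/-- The class `U_π` of the groups in which `x ↦ x ^ m` is injective for all `m ∈ π'`. -/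
def IsU (π : Set ℕ) (G : Type u) [Group G] : Prop :=
  ∀ m : ℕ, IsPrimeTo π m → Function.Injective fun x : G => x ^ m

/-- The additive group `ℤ_π` of the rational numbers whose denominators lie in `π'`. -/
def zLocal (π : Set ℕ) : AddSubgroup ℚ where
  carrier := {r | IsPrimeTo π r.den}
  zero_mem' := ⟨Rat.den_pos _, fun p hp h => absurd (Nat.dvd_one.mp h) hp.ne_one⟩
  add_mem' := by
    intro a b ha hb
    refine ⟨Rat.den_pos _, fun p hp h => ?_⟩
    rcases (Nat.Prime.dvd_mul hp).mp (h.trans (Rat.add_den_dvd a b)) with h | h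
    exacts [ha.2 p hp h, hb.2 p hp h]
  neg_mem' := by
    intro a ha
    simpa using ha

/-- The centralizer `C_G(x)`. -/
def cent {G : Type u} [Group G] (x : G) : Subgroup G := Subgroup.centralizer {x}

/-- The conjugate `C ^ g = g⁻¹ C g`. -/
def conjSubgroup {G : Type u} [Group G] (C : Subgroup G) (g : G) : Subgroup G :=
  C.map (MulAut.conj g⁻¹).toMonoidHom

/-- The set `D_G(x)` of the elements `g` with `C_G(x) ∩ C_G(x) ^ g ≠ 1`. -/
def dSet {G : Type u} [Group G] (x : G) : Set G :=
  {g | cent x ⊓ conjSubgroup (cent x) g ≠ ⊥}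

/-- The class `P_π`. In the second alternative, `|D_G(x) : C_G(x)| = 2` says that `D_G(x)` is
a subgroup that contains `C_G(x)` with index two, and `C_G(x) ≤ ℤ_π` says that `C_G(x)` is
isomorphic to a subgroup of `ℤ_π`. -/
def IsP (π : Set ℕ) (G : Type u) [Group G] : Prop :=
  IsU π G ∧
  ∀ x : G, (∃ m : ℕ, IsPrimeTo π m ∧ ∀ y : G, y ^ m ≠ x) →
    (∀ c ∈ cent x, IsOfFinOrder c → c = 1) ∧
    (dSet x = (cent x : Set G) ∨
      ((∃ D : Subgroup G, (D : Set G) = dSet x ∧ cent x ≤ D ∧ (cent x).relIndex D = 2) ∧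
        ∃ f : cent x →* Multiplicative (zLocal π), Function.Injective f))

/-! Every group has a `π`-localization: it is built from formal terms. -/

/-- Formal terms in the elements of `G`, the group operations and `q`-th roots for `q ∉ π`. -/
inductive Term (π : Set ℕ) (G : Type u) : Type u
  | of (g : G) : Term π G
  | one : Term π G
  | mul (s t : Term π G) : Term π G
  | inv (t : Term π G) : Term π G
  | root (q : {q : ℕ // q.Prime ∧ q ∉ π}) (t : Term π G) : Term π G

/-- Formal powers. -/
def Term.npow {π : Set ℕ} {G : Type u} (t : Term π G) : ℕ → Term π G
  | 0 => .one
  | n + 1 => .mul (Term.npow t n) t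

/-- The congruence that imposes the group laws, the relations of `G`, and that `q`-th roots exist
and are unique. -/
inductive Rel (π : Set ℕ) (G : Type u) [Group G] : Term π G → Term π G → Prop
  | refl (s) : Rel π G s s
  | symm {s t} : Rel π G s t → Rel π G t s
  | trans {s t r} : Rel π G s t → Rel π G t r → Rel π G s r
  | mul_congr {s s' t t'} : Rel π G s s' → Rel π G t t' → Rel π G (.mul s t) (.mul s' t')
  | inv_congr {s s'} : Rel π G s s' → Rel π G (.inv s) (.inv s')
  | root_congr (q) {s s'} : Rel π G s s' → Rel π G (.root q s) (.root q s')
  | mul_assoc (s t r) : Rel π G (.mul (.mul s t) r) (.mul s (.mul t r))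
  | one_mul (s) : Rel π G (.mul .one s) s
  | mul_one (s) : Rel π G (.mul s .one) s
  | inv_mul (s) : Rel π G (.mul (.inv s) s) .one
  | of_mul (g h : G) : Rel π G (.of (g * h)) (.mul (.of g) (.of h))
  | root_pow (q) (s) : Rel π G (Term.npow (.root q s) q.1) s
  | pow_root (q) (s) : Rel π G (.root q (Term.npow s q.1)) s

/-- The setoid of `Rel`. -/
def termSetoid (π : Set ℕ) (G : Type u) [Group G] : Setoid (Term π G) :=
  ⟨Rel π G, ⟨Rel.refl, Rel.symm, Rel.trans⟩⟩

/-- A model of `G_π`. -/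
def Loc (π : Set ℕ) (G : Type u) [Group G] : Type u := Quotient (termSetoid π G)

instance (π : Set ℕ) (G : Type u) [Group G] : Mul (Loc π G) :=
  ⟨Quotient.map₂ Term.mul fun _ _ h _ _ h' => Rel.mul_congr h h'⟩

instance (π : Set ℕ) (G : Type u) [Group G] : Inv (Loc π G) :=
  ⟨Quotient.map Term.inv fun _ _ h => Rel.inv_congr h⟩

instance (π : Set ℕ) (G : Type u) [Group G] : One (Loc π G) :=
  ⟨Quotient.mk (termSetoid π G) Term.one⟩

instance (π : Set ℕ) (G : Type u) [Group G] : Group (Loc π G) :=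
  Group.ofLeftAxioms
    (by
      rintro ⟨a⟩ ⟨b⟩ ⟨c⟩
      exact Quotient.sound (s := termSetoid π G) (Rel.mul_assoc a b c))
    (by
      rintro ⟨a⟩
      exact Quotient.sound (s := termSetoid π G) (Rel.one_mul a))
    (by
      rintro ⟨a⟩
      exact Quotient.sound (s := termSetoid π G) (Rel.inv_mul a))

/-- The class of a term. -/
def Loc.mk {π : Set ℕ} {G : Type u} [Group G] (t : Term π G) : Loc π G :=
  Quotient.mk (termSetoid π G) t

theorem Loc.mk_mul {π : Set ℕ} {G : Type u} [Group G] (s t : Term π G) :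
    Loc.mk (.mul s t) = Loc.mk s * Loc.mk t := rfl

theorem Loc.mk_inv {π : Set ℕ} {G : Type u} [Group G] (s : Term π G) :
    Loc.mk (.inv s) = (Loc.mk s)⁻¹ := rfl

theorem Loc.mk_one {π : Set ℕ} {G : Type u} [Group G] :
    Loc.mk (.one : Term π G) = 1 := rfl

theorem Loc.mk_npow {π : Set ℕ} {G : Type u} [Group G] (s : Term π G) (n : ℕ) :
    Loc.mk (s.npow n) = Loc.mk s ^ n := by
  induction n with
  | zero => rw [pow_zero]; rfl
  | succ n ih => rw [pow_succ, ← ih]; rfl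

/-- The canonical homomorphism from `G` to its localization. -/
def Loc.of (π : Set ℕ) (G : Type u) [Group G] : G →* Loc π G :=
  MonoidHom.mk' (fun g => Loc.mk (.of g)) fun g h =>
    Quotient.sound (s := termSetoid π G) (Rel.of_mul g h)

theorem Loc.isLocal (π : Set ℕ) (G : Type u) [Group G] : IsLocal π (Loc π G) := by
  intro q hq hqπ
  constructor
  · rintro ⟨a⟩ ⟨b⟩ h
    change Loc.mk a ^ q = Loc.mk b ^ q at h
    rw [← Loc.mk_npow, ← Loc.mk_npow] at h
    have h' : Rel π G (a.npow q) (b.npow q) := Quotient.exact (s := termSetoid π G) h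
    exact Quotient.sound (s := termSetoid π G)
      (((Rel.pow_root ⟨q, hq, hqπ⟩ a).symm.trans (Rel.root_congr ⟨q, hq, hqπ⟩ h')).trans
        (Rel.pow_root ⟨q, hq, hqπ⟩ b))
  · rintro ⟨a⟩
    refine ⟨Loc.mk (.root ⟨q, hq, hqπ⟩ a), ?_⟩
    change Loc.mk _ ^ q = Loc.mk a
    rw [← Loc.mk_npow]
    exact Quotient.sound (s := termSetoid π G) (Rel.root_pow ⟨q, hq, hqπ⟩ a)

/-- Evaluation of terms in a `π`-local group. -/
noncomputable def Term.eval {π : Set ℕ} {G : Type u} [Group G] {H : Type v} [Group H]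
    (hH : IsLocal π H) (θ : G →* H) : Term π G → H
  | .of g => θ g
  | .one => 1
  | .mul s t => Term.eval hH θ s * Term.eval hH θ t
  | .inv s => (Term.eval hH θ s)⁻¹
  | .root q s => ((hH q.1 q.2.1 q.2.2).2 (Term.eval hH θ s)).choose

theorem Term.eval_npow {π : Set ℕ} {G : Type u} [Group G] {H : Type v} [Group H]
    (hH : IsLocal π H) (θ : G →* H) (s : Term π G) (n : ℕ) :
    (s.npow n).eval hH θ = s.eval hH θ ^ n := by
  induction n with
  | zero => rw [pow_zero]; rfl
  | succ n ih => rw [pow_succ, ← ih]; rfl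

theorem Term.eval_root {π : Set ℕ} {G : Type u} [Group G] {H : Type v} [Group H]
    (hH : IsLocal π H) (θ : G →* H) (q) (s : Term π G) :
    (Term.root q s).eval hH θ ^ q.1 = s.eval hH θ :=
  ((hH q.1 q.2.1 q.2.2).2 (Term.eval hH θ s)).choose_spec

theorem Rel.eval_eq {π : Set ℕ} {G : Type u} [Group G] {H : Type v} [Group H]
    (hH : IsLocal π H) (θ : G →* H) {s t : Term π G} (h : Rel π G s t) :
    s.eval hH θ = t.eval hH θ := by
  induction h with
  | refl => rfl
  | symm _ ih => exact ih.symm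
  | trans _ _ ih ih' => exact ih.trans ih'
  | mul_congr _ _ ih ih' => simp only [Term.eval, ih, ih']
  | inv_congr _ ih => simp only [Term.eval, ih]
  | root_congr q _ ih => simp only [Term.eval, ih]
  | mul_assoc => simp only [Term.eval, _root_.mul_assoc]
  | one_mul => simp only [Term.eval, _root_.one_mul]
  | mul_one => simp only [Term.eval, _root_.mul_one]
  | inv_mul => simp only [Term.eval, inv_mul_cancel]
  | of_mul => simp only [Term.eval, map_mul]
  | root_pow q s => rw [Term.eval_npow, Term.eval_root]
  | pow_root q s =>
    apply (hH q.1 q.2.1 q.2.2).1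
    change _ ^ q.1 = _ ^ q.1
    rw [Term.eval_root, Term.eval_npow]

/-- Localizations exist. -/
theorem Loc.isLocalization (π : Set ℕ) (G : Type u) [Group G] :
    IsLocalization π (Loc.of π G) := by
  refine ⟨Loc.isLocal π G, fun H _ hH θ => ?_⟩
  refine ⟨MonoidHom.mk' (Quotient.lift (s := termSetoid π G) (Term.eval hH θ)
    fun _ _ h => Rel.eval_eq hH θ h) ?_, ?_, ?_⟩
  · rintro ⟨a⟩ ⟨b⟩
    rfl
  · ext g
    rfl
  · intro θ' h
    ext ⟨a⟩
    change θ' (Loc.mk a) = a.eval hH θ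
    induction a with
    | of g => exact DFunLike.congr_fun h g
    | one => exact map_one θ'
    | mul s t ihs iht => rw [Loc.mk_mul, map_mul, ihs, iht]; rfl
    | inv s ih => rw [Loc.mk_inv, map_inv, ih]; rfl
    | root q s ih =>
      apply (hH q.1 q.2.1 q.2.2).1
      change _ ^ q.1 = _ ^ q.1
      rw [Term.eval_root, ← map_pow, ← Loc.mk_npow, ← ih]
      exact congrArg θ' (Quotient.sound (s := termSetoid π G) (Rel.root_pow q s))

end PiGroup

/-! Unique roots make centralizers root closed, so the root closure of a nilpotent subgroup of a
`π`-local group is nilpotent. With a finite-index argument it follows that `L`, the root closure of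
the image of `G`, is virtually nilpotent as soon as this image is. Otherwise the image is a finitely
generated metabelian group `Q` with unique roots that is not virtually nilpotent. In the second
claim `Q` is `G ⧸ N`, and what is taken from `P_π` is that roots are unique. Both claims then rest
on `IsLocalization.not_isSolvable`: such a quotient `Q` forces `L` to be insoluble.

The derived group of `Q` is a finite faithful module over the commutative Noetherian ring generated
by conjugation. If the image of `Q` were finite modulo every minimal prime, a subgroup of finite
index would act unipotently and `Q` would be virtually nilpotent. So some minimal prime yields a
character `χ` with infinite image and a `χ`-equivariant functional `φ`, hence an affine
representation of `Q` on a line over an algebraically closed field `K`. Unique roots become the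
nonvanishing of `1 + χ g + ⋯ + χ g ^ (q - 1)` for primes `q ∉ π` (`exists_affine_character`).

This representation is placed in a large `π`-local group: power series over the 2 × 2 matrices with
constant term `1`, extended by a torus `T`. The torus acts by a character `X` extending `χ` and by a
character `Z` that is trivial on `Q` but not on a root `s` of the image of some `t` in `Q`. The root
of `t` in `L` must map to `s`, and conjugation by `s` moves a one-parameter unipotent group to new
directions. Three directions suffice to keep all iterated commutators nontrivial, by following top
coefficients of polynomials (`HasAllEnds.commutator`).

The quotient in `P_π` asked for in the first claim is simply infinite cyclic. It exists unless `G`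
has finite abelianization, and then the abelian derived group makes `G` virtually nilpotent. -/

namespace PiGroup

open scoped IsMulCommutative commutatorElement

/-! ### Root closures in `π`-local groups and virtual nilpotency. -/

section RootClosure

variable {π : Set ℕ} {S : Type u} [Group S]

/-- A subgroup is root closed if it contains the `q`-th roots of its elements for primes `q ∉ π`. -/
def RootClosed (π : Set ℕ) (H : Subgroup S) : Prop :=
  ∀ q : ℕ, q.Prime → q ∉ π → ∀ x : S, x ^ q ∈ H → x ∈ H

/-- The smallest root closed subgroup containing `H`. -/
def rootClosure (π : Set ℕ) (H : Subgroup S) : Subgroup S :=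
  sInf {K | H ≤ K ∧ RootClosed π K}

theorem le_rootClosure (H : Subgroup S) : H ≤ rootClosure π H :=
  le_sInf fun _ h => h.1

theorem rootClosed_rootClosure (H : Subgroup S) : RootClosed π (rootClosure π H) := by
  intro q hq hqπ x hx
  simp only [rootClosure, Subgroup.mem_sInf] at hx ⊢
  exact fun K hK => hK.2 q hq hqπ x (hx K hK)

theorem rootClosure_le {H K : Subgroup S} (h : H ≤ K) (hK : RootClosed π K) :
    rootClosure π H ≤ K :=
  sInf_le ⟨h, hK⟩

theorem RootClosed.isLocal (hS : IsLocal π S) {H : Subgroup S} (hH : RootClosed π H) :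
    IsLocal π H := by
  intro q hq hqπ
  constructor
  · intro x y h
    apply Subtype.ext
    apply (hS q hq hqπ).1
    simpa using congrArg Subtype.val h
  · rintro ⟨x, hx⟩
    obtain ⟨y, hy⟩ := (hS q hq hqπ).2 x
    exact ⟨⟨y, hH q hq hqπ y (by simpa only [hy] using hx)⟩, Subtype.ext hy⟩

theorem rootClosed_bot (hS : IsLocal π S) : RootClosed π (⊥ : Subgroup S) := by
  intro q hq hqπ x hx
  rw [Subgroup.mem_bot] at hx ⊢
  exact (hS q hq hqπ).1 (by simpa using hx)

/-- The conjugate of `x` by `z` has the same `q`-th power as `x`, and roots are unique. -/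
theorem IsLocal.commute_of_pow (hS : IsLocal π S) {q : ℕ} (hq : q.Prime) (hqπ : q ∉ π) {x z : S}
    (h : Commute z (x ^ q)) : Commute z x := by
  have : z * x * z⁻¹ = x := by
    apply (hS q hq hqπ).1
    simp only [conj_pow]
    rw [h.eq, mul_inv_cancel_right]
  exact mul_inv_eq_iff_eq_mul.mp this

theorem rootClosed_centralizer (hS : IsLocal π S) (z : S) :
    RootClosed π (Subgroup.centralizer {z}) := by
  intro q hq hqπ x hx
  rw [Subgroup.mem_centralizer_singleton_iff] at hx ⊢
  exact (hS.commute_of_pow hq hqπ (z := z) hx.symm).eq.symm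

theorem rootClosed_center (hS : IsLocal π S) : RootClosed π (Subgroup.center S) := by
  intro q hq hqπ x hx
  rw [Subgroup.mem_center_iff] at hx ⊢
  exact fun g => (hS.commute_of_pow hq hqπ (hx g)).eq

theorem rootClosed_comap {T : Type v} [Group T] (f : S →* T) {K : Subgroup T}
    (hK : RootClosed π K) : RootClosed π (K.comap f) := by
  intro q hq hqπ x hx
  rw [Subgroup.mem_comap, map_pow] at hx
  exact hK q hq hqπ _ hx

/-- For injectivity, the `q`-th root of a central discrepancy between `x ^ q` and `y ^ q` is itself
central, so it can be absorbed into `x`. -/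
theorem IsLocal.quotient_center (hS : IsLocal π S) : IsLocal π (S ⧸ Subgroup.center S) := by
  intro q hq hqπ
  constructor
  · intro x y h
    induction x using QuotientGroup.induction_on with | H x => ?_
    induction y using QuotientGroup.induction_on with | H y => ?_
    change ((x ^ q : S) : S ⧸ Subgroup.center S) = ((y ^ q : S) : S ⧸ Subgroup.center S) at h
    rw [QuotientGroup.eq] at h ⊢
    obtain ⟨w, hw⟩ := (hS q hq hqπ).2 ((x ^ q)⁻¹ * y ^ q)
    have hwc : w ∈ Subgroup.center S := rootClosed_center hS q hq hqπ w (by rwa [← hw] at h)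
    have : y = x * w := by
      apply (hS q hq hqπ).1
      have hc : Commute x w := (Subgroup.mem_center_iff.mp hwc x)
      simp only [hc.mul_pow]
      rw [show w ^ q = _ from hw, mul_inv_cancel_left]
    rw [this, inv_mul_cancel_left]
    exact hwc
  · intro x
    induction x using QuotientGroup.induction_on with | H x => ?_
    obtain ⟨w, hw⟩ := (hS q hq hqπ).2 x
    exact ⟨(w : S ⧸ Subgroup.center S), congrArg _ hw⟩

/-- The penultimate term of the series of `N` is centralized by `N`. Centralizers are root closed,
so it is centralized by all of `S`. Dividing by the center keeps the group local and lowers `n`. -/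
theorem isNilpotent_of_rootClosure_eq_top (n : ℕ) : ∀ {S : Type u} [Group S], IsLocal π S →
    ∀ N : Subgroup S, rootClosure π N = ⊤ → N.lowerCentralSeries n = ⊥ → Group.IsNilpotent S := by
  induction n with
  | zero =>
    intro S _ hS N hN h
    rw [Subgroup.lowerCentralSeries_zero] at h
    have : (⊤ : Subgroup S) ≤ ⊥ := hN ▸ rootClosure_le h.le (rootClosed_bot hS)
    have : Subsingleton S := by
      rw [← Subgroup.subsingleton_iff]
      exact subsingleton_of_bot_eq_top (top_le_iff.mp this)
    infer_instance
  | succ n ih =>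
    intro S _ hS N hN h
    have hc : N.lowerCentralSeries n ≤ Subgroup.center S := by
      intro z hz
      rw [Subgroup.lowerCentralSeries_succ, Subgroup.commutator_eq_bot_iff_le_centralizer] at h
      have : rootClosure π N ≤ Subgroup.centralizer {z} := by
        refine rootClosure_le (fun x hx => ?_) (rootClosed_centralizer hS z)
        rw [Subgroup.mem_centralizer_singleton_iff]
        exact Subgroup.mem_centralizer_iff.mp (h hz) x hx
      rw [hN] at this
      rw [Subgroup.mem_center_iff]
      exact fun g => Subgroup.mem_centralizer_singleton_iff.mp (this (Subgroup.mem_top g))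
    apply Group.of_quotient_center_nilpotent
    refine ih hS.quotient_center (N.map (QuotientGroup.mk' _)) ?_ ?_
    · have : rootClosure π N ≤ (rootClosure π (N.map (QuotientGroup.mk'
          (Subgroup.center S)))).comap (QuotientGroup.mk' _) :=
        rootClosure_le (Subgroup.map_le_iff_le_comap.mp (le_rootClosure _))
          (rootClosed_comap _ (rootClosed_rootClosure _))
      rw [hN, ← Subgroup.map_le_iff_le_comap, ← MonoidHom.range_eq_map,
        MonoidHom.range_eq_top.mpr (QuotientGroup.mk'_surjective _)] at this
      exact top_le_iff.mp this
    · rw [← Subgroup.map_lowerCentralSeries, Subgroup.map_eq_bot_iff, QuotientGroup.ker_mk']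
      exact hc

theorem isNilpotent_rootClosure (hS : IsLocal π S) (N : Subgroup S) [hN : Group.IsNilpotent N] :
    Group.IsNilpotent (rootClosure π N) := by
  obtain ⟨n, hn⟩ := (Subgroup.isNilpotent_iff_lowerCentralSeries N).mp hN
  have hle := le_rootClosure (π := π) N
  refine isNilpotent_of_rootClosure_eq_top (π := π) n
    ((rootClosed_rootClosure N).isLocal hS) (N.subgroupOf _) ?_ ?_
  · rw [eq_top_iff]
    rintro ⟨x, hx⟩ -
    have : rootClosure π N ≤ (rootClosure π (N.subgroupOf (rootClosure π N))).map
        (rootClosure π N).subtype := by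
      refine rootClosure_le ?_ ?_
      · intro y hy
        exact ⟨⟨y, hle hy⟩, le_rootClosure _ hy, rfl⟩
      · rintro q hq hqπ y ⟨w, hw, hwy⟩
        have hy : y ∈ rootClosure π N :=
          rootClosed_rootClosure N q hq hqπ y (hwy ▸ w.2)
        refine ⟨⟨y, hy⟩, rootClosed_rootClosure _ q hq hqπ _ ?_, rfl⟩
        have : (⟨y, hy⟩ : rootClosure π N) ^ q = w := Subtype.ext hwy.symm
        rwa [this]
    obtain ⟨w, hw, rfl⟩ := this hx
    exact hw
  · rw [← (Subgroup.map_eq_bot_iff_of_injective _ (Subgroup.subtype_injective _)),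
      Subgroup.map_lowerCentralSeries, Subgroup.map_subgroupOf_eq_of_le hle, hn]

theorem exists_mul_pow_eq {H N : Subgroup S} (hHN : H ≤ Subgroup.normalizer (N : Set S)) {g m : S}
    (hg : g ∈ H) (hm : m ∈ N) (k : ℕ) : ∃ n ∈ N, (g * m) ^ k = g ^ k * n := by
  induction k with
  | zero => exact ⟨1, N.one_mem, by simp⟩
  | succ k ih =>
    obtain ⟨n, hn, h⟩ := ih
    refine ⟨g⁻¹ * n * g * m, N.mul_mem ?_ hm, by rw [pow_succ, h, pow_succ]; group⟩
    simpa using (Subgroup.mem_normalizer_iff.mp (hHN (H.inv_mem hg)) n).mp hn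

/-- If `s ^ q` lies in the join, finite index puts a power of `s` into the root closure of `N`.
Taking roots there makes the exponent prime to `q`, and Bézout recovers `s`. -/
theorem rootClosed_sup_rootClosure {H N : Subgroup S}
    (hHN : H ≤ Subgroup.normalizer (rootClosure π N : Set S)) (hfin : N.relIndex H ≠ 0) :
    RootClosed π (H ⊔ rootClosure π N) := by
  intro q hq hqπ s hs
  have hs' := hs
  rw [← SetLike.mem_coe, Subgroup.coe_mul_of_left_le_normalizer_right _ _ hHN] at hs
  obtain ⟨g, hg, m, hm, hgm⟩ := hs
  obtain ⟨k, hk, -, hgk⟩ := Subgroup.exists_pow_mem_of_relIndex_ne_zero hfin hg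
  have h1 : s ^ (q * k) ∈ rootClosure π N := by
    obtain ⟨n, hn, h⟩ := exists_mul_pow_eq hHN hg hm k
    rw [pow_mul, ← hgm]
    change (g * m) ^ k ∈ _
    rw [h]
    exact mul_mem (le_rootClosure _ hgk.1) hn
  -- The exponent may be divisible by `q`; root closedness strips these factors and leaves `c`.
  obtain ⟨e, c, hc, rfl⟩ := Nat.exists_eq_pow_mul_and_not_dvd hk.ne' q hq.ne_one
  have h2 : s ^ c ∈ rootClosure π N := by
    have : ∀ j, s ^ (q ^ j * c) ∈ rootClosure π N → s ^ c ∈ rootClosure π N := by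
      intro j
      induction j with
      | zero => simp
      | succ j ih =>
        intro h
        apply ih
        apply rootClosed_rootClosure N q hq hqπ
        rw [← pow_mul]
        convert h using 2
        ring
    apply this (e + 1)
    convert h1 using 2
    ring
  have hcop : IsCoprime (q : ℤ) c := by
    rw [Nat.isCoprime_iff_coprime]
    exact (Nat.Prime.coprime_iff_not_dvd hq).mpr hc
  obtain ⟨a, b, hab⟩ := hcop
  have : s = (s ^ q) ^ a * (s ^ c) ^ b := by
    rw [← zpow_natCast, ← zpow_natCast, ← zpow_mul, ← zpow_mul, ← zpow_add, mul_comm _ a,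
      mul_comm _ b, hab, zpow_one]
  rw [this]
  exact mul_mem (zpow_mem hs' _) (zpow_mem (Subgroup.mem_sup_right h2) _)

theorem le_normalizer_rootClosure {H N : Subgroup S}
    (hHN : H ≤ Subgroup.normalizer (N : Set S)) :
    H ≤ Subgroup.normalizer (rootClosure π N : Set S) := by
  have key : ∀ g ∈ H, ∀ x ∈ rootClosure π N, g * x * g⁻¹ ∈ rootClosure π N := by
    intro g hg
    have : rootClosure π N ≤ (rootClosure π N).comap (MulAut.conj g).toMonoidHom := by
      refine rootClosure_le (fun x hx => ?_) (rootClosed_comap _ (rootClosed_rootClosure _))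
      exact le_rootClosure _ ((Subgroup.mem_normalizer_iff.mp (hHN hg) x).mp hx)
    exact fun x hx => this hx
  intro g hg
  rw [Subgroup.mem_normalizer_iff]
  refine fun x => ⟨key g hg x, fun h => ?_⟩
  have := key g⁻¹ (H.inv_mem hg) _ h
  simpa [mul_assoc] using this

/-- A local group is virtually nilpotent if it is the root closure of such a subgroup. -/
theorem isVirtuallyNilpotent_of_rootClosure (hS : IsLocal π S) {H : Subgroup S}
    (htop : rootClosure π H = ⊤) (hH : Group.IsVirtuallyNilpotent H) :
    Group.IsVirtuallyNilpotent S := by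
  obtain ⟨M, hM, hfin⟩ := hH
  -- The normal core is used so that `H` normalizes its image and the root closure of that image.
  have hnil : Group.IsNilpotent M.normalCore :=
    Group.nilpotent_of_mulEquiv
      (Subgroup.subgroupOfEquivOfLe (Subgroup.normalCore_le M))
  set N : Subgroup S := M.normalCore.map H.subtype with hN
  have : Group.IsNilpotent N := Group.nilpotent_of_mulEquiv
    (M.normalCore.equivMapOfInjective _ H.subtype_injective)
  have hHN : H ≤ Subgroup.normalizer (N : Set S) := by
    have := Subgroup.le_normalizer_map (H := M.normalCore) H.subtype
    rwa [Subgroup.normalizer_eq_top, ← MonoidHom.range_eq_map, Subgroup.range_subtype] at this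
  have hrel : N.relIndex H ≠ 0 := by
    have h1 : (M.normalCore).relIndex ⊤ ≠ 0 := by
      rw [Subgroup.relIndex_top_right]
      exact Subgroup.FiniteIndex.index_ne_zero
    rw [← Subgroup.relIndex_map_map_of_injective _ _ H.subtype_injective,
      ← MonoidHom.range_eq_map, Subgroup.range_subtype] at h1
    exact h1
  have hn := le_normalizer_rootClosure (π := π) hHN
  have hsup : H ⊔ rootClosure π N = ⊤ :=
    top_le_iff.mp (htop ▸ rootClosure_le le_sup_left (rootClosed_sup_rootClosure hn hrel))
  have hnorm : (rootClosure π N).Normal := by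
    rw [← Subgroup.normalizer_eq_top_iff, ← top_le_iff, ← hsup]
    exact sup_le hn Subgroup.le_normalizer
  refine ⟨rootClosure π N, isNilpotent_rootClosure hS N, ⟨?_⟩⟩
  rw [← Subgroup.relIndex_top_right, ← hsup, Subgroup.relIndex_sup_right]
  exact fun h => hrel (Subgroup.relIndex_eq_zero_of_le_left (le_rootClosure _) h)

/-- A localization is the root closure of the image of the group. -/
theorem IsLocalization.rootClosure_range {G L : Type u} [Group G] [Group L] {l : G →* L}
    (hl : IsLocalization π l) : rootClosure π l.range = ⊤ := by
  set K := rootClosure π l.range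
  obtain ⟨r, hr, -⟩ := hl.existsUnique_lift K ((rootClosed_rootClosure _).isLocal hl.isLocal)
    (l.codRestrict K fun g => le_rootClosure _ ⟨g, rfl⟩)
  -- Both the retraction followed by inclusion and the identity lift `l`, so they agree.
  have h := (hl.existsUnique_lift L hl.isLocal l).unique (y₁ := K.subtype.comp r)
    (y₂ := MonoidHom.id L) (by rw [MonoidHom.comp_assoc, hr]; rfl) (by ext; rfl)
  rw [eq_top_iff]
  intro x _
  rw [← MonoidHom.id_apply L x, ← h]
  exact (r x).2

theorem IsLocalization.isVirtuallyNilpotent {G L : Type u} [Group G] [Group L] {l : G →* L}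
    (hl : IsLocalization π l) (h : Group.IsVirtuallyNilpotent l.range) :
    Group.IsVirtuallyNilpotent L :=
  isVirtuallyNilpotent_of_rootClosure hl.isLocal hl.rootClosure_range h

end RootClosure

/-! ### Residue fields of faithful modules at minimal primes. -/

section Residue

open Ideal

/-- A finite faithful module has a nonzero functional with values in the residue field of any
prime. -/
theorem exists_functional_residueField {R A : Type u} [CommRing R] [AddCommGroup A] [Module R A]
    [Module.Finite R A] (hfaith : ∀ r : R, (∀ a : A, r • a = 0) → r = 0) (p : Ideal R)
    [hp : p.IsPrime] : ∃ φ : A →+ p.ResidueField,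
      (∀ (r : R) (a : A), φ (r • a) = algebraMap R _ r * φ a) ∧ ∃ a, φ a ≠ 0 := by
  -- A finite module with zero annihilator is supported at every prime.
  have hmem : (⟨p, hp⟩ : PrimeSpectrum R) ∈ Module.support R A := by
    rw [Module.support_eq_zeroLocus, PrimeSpectrum.mem_zeroLocus]
    intro r hr
    rw [hfaith r (Module.mem_annihilator.mp hr)]
    exact p.zero_mem
  rw [Module.mem_support_iff_nontrivial_residueField_tensorProduct] at hmem
  obtain ⟨a, ha⟩ : ∃ a : A, (1 : p.ResidueField) ⊗ₜ[R] a ≠ 0 := by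
    by_contra! h
    obtain ⟨x, hx⟩ := exists_ne (0 : TensorProduct R p.ResidueField A)
    apply hx
    induction x using TensorProduct.induction_on with
    | zero => rfl
    | tmul c a =>
      rw [← mul_one c, ← smul_eq_mul, ← TensorProduct.smul_tmul', h a, smul_zero]
    | add x y ihx ihy =>
      by_cases h1 : x = 0
      · by_cases h2 : y = 0
        · rw [h1, h2, add_zero]
        · exact absurd (ihy h2) h2
      · exact absurd (ihx h1) h1
  have := mt (Module.forall_dual_apply_eq_zero_iff p.ResidueField
    ((1 : p.ResidueField) ⊗ₜ[R] a)).mp ha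
  push Not at this
  obtain ⟨ψ, hψ⟩ := this
  refine ⟨ψ.toAddMonoidHom.comp ((TensorProduct.mk R p.ResidueField A 1).toAddMonoidHom), ?_, a, hψ⟩
  intro r b
  change ψ (1 ⊗ₜ[R] (r • b)) = _ * ψ (1 ⊗ₜ[R] b)
  rw [← smul_eq_mul, ← map_smul, TensorProduct.smul_tmul', ← TensorProduct.smul_tmul]
  congr 2
  rw [Algebra.smul_def, smul_eq_mul]

/-- Multiplicative maps to a Noetherian ring whose images modulo the minimal primes are finite are
unipotent on a subgroup of finite index. -/
theorem exists_minimalPrimes_or_unipotent {R : Type u} [CommRing R] [IsNoetherianRing R]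
    {Q : Type u} [Group Q] (c : Q →* R) :
    (∃ p : Ideal R, ∃ _ : p.IsPrime, p ∈ minimalPrimes R ∧
      (Set.range fun g => algebraMap R p.ResidueField (c g)).Infinite) ∨
    ∃ Q₀ : Subgroup Q, Q₀.FiniteIndex ∧ ∀ g ∈ Q₀, c g - 1 ∈ nilradical R := by
  by_cases h : ∃ p : Ideal R, ∃ _ : p.IsPrime, p ∈ minimalPrimes R ∧
      (Set.range fun g => algebraMap R p.ResidueField (c g)).Infinite
  · exact Or.inl h
  right
  push Not at h
  have hprime : ∀ p : minimalPrimes R, p.1.IsPrime := fun p => p.2.1.1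
  let f : ∀ p : minimalPrimes R, Q →* (letI := hprime p; p.1.ResidueField)ˣ := fun p =>
    letI := hprime p
    ((algebraMap R p.1.ResidueField).toMonoidHom.comp c).toHomUnits
  have : Finite (minimalPrimes R) := minimalPrimes.finite_of_isNoetherianRing R
  refine ⟨⨅ p, (f p).ker, Subgroup.finiteIndex_iInf fun p => ?_, ?_⟩
  · have := hprime p
    have hfin := h p.1 (hprime p) p.2
    have : Finite (f p).range := by
      refine Set.Finite.to_subtype (Set.Finite.of_finite_image
        (f := fun x : p.1.ResidueFieldˣ => (x : p.1.ResidueField))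
        (hfin.subset ?_) Units.val_injective.injOn)
      rintro _ ⟨_, ⟨g, rfl⟩, rfl⟩
      exact ⟨g, rfl⟩
    exact Subgroup.finiteIndex_ker (f p)
  · intro g hg
    rw [nilradical, ← Ideal.sInf_minimalPrimes, Submodule.mem_sInf]
    intro p hp
    have := hprime ⟨p, hp⟩
    have h1 : f ⟨p, hp⟩ g = 1 := by
      rw [Subgroup.mem_iInf] at hg
      exact hg ⟨p, hp⟩
    rw [← Ideal.algebraMap_residueField_eq_zero, map_sub, map_one, sub_eq_zero]
    exact congrArg Units.val h1

end Residue

/-! ### The derived group as a module under conjugation. -/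

section Conjugation

variable {Q : Type u} [Group Q]

/-- Modulo the normal closure the generators commute with one another; their centralizers are
subgroups, so each is central, and the quotient is abelian. -/
theorem commutator_le_normalClosure_of_closure_eq_top {s : Set Q} (hs : Subgroup.closure s = ⊤) :
    commutator Q ≤ Subgroup.normalClosure {x | ∃ a ∈ s, ∃ b ∈ s, ⁅a, b⁆ = x} := by
  set N := Subgroup.normalClosure {x | ∃ a ∈ s, ∃ b ∈ s, ⁅a, b⁆ = x}
  have h1 : ∀ a ∈ s, ∀ g : Q, ⁅a, g⁆ ∈ N := by
    intro a ha g
    have : (⊤ : Subgroup Q) ≤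
        (Subgroup.centralizer {(a : Q ⧸ N)}).comap (QuotientGroup.mk' N) := by
      rw [← hs, Subgroup.closure_le]
      intro b hb
      rw [SetLike.mem_coe, Subgroup.mem_comap, Subgroup.mem_centralizer_singleton_iff]
      have : ⁅b, a⁆ ∈ N := Subgroup.subset_normalClosure ⟨b, hb, a, ha, rfl⟩
      rw [← QuotientGroup.eq_one_iff, ← QuotientGroup.mk'_apply, map_commutatorElement,
        commutatorElement_eq_one_iff_mul_comm] at this
      exact this
    have h := this (Subgroup.mem_top g)
    rw [Subgroup.mem_comap, Subgroup.mem_centralizer_singleton_iff] at h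
    rw [← QuotientGroup.eq_one_iff, ← QuotientGroup.mk'_apply, map_commutatorElement,
        commutatorElement_eq_one_iff_mul_comm]
    exact h.symm
  rw [commutator_def, Subgroup.commutator_le]
  intro g _ h _
  have : (⊤ : Subgroup Q) ≤
      (Subgroup.centralizer {(h : Q ⧸ N)}).comap (QuotientGroup.mk' N) := by
    rw [← hs, Subgroup.closure_le]
    intro a ha
    rw [SetLike.mem_coe, Subgroup.mem_comap, Subgroup.mem_centralizer_singleton_iff]
    have := h1 a ha h
    rw [← QuotientGroup.eq_one_iff, ← QuotientGroup.mk'_apply, map_commutatorElement,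
      commutatorElement_eq_one_iff_mul_comm] at this
    exact this
  have hh := this (Subgroup.mem_top g)
  rw [Subgroup.mem_comap, Subgroup.mem_centralizer_singleton_iff] at hh
  rw [← QuotientGroup.eq_one_iff, ← QuotientGroup.mk'_apply, map_commutatorElement,
      commutatorElement_eq_one_iff_mul_comm]
  exact hh

/-- The subgroup of `Q` corresponding to an additive subgroup of the derived group. -/
def liftCommutator (M : AddSubgroup (Additive (commutator Q))) : Subgroup Q where
  carrier := {x | ∃ h : x ∈ commutator Q, Additive.ofMul ⟨x, h⟩ ∈ M}
  one_mem' := ⟨one_mem _, M.zero_mem⟩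
  mul_mem' := fun ⟨h, hx⟩ ⟨h', hy⟩ => ⟨mul_mem h h', M.add_mem hx hy⟩
  inv_mem' := fun ⟨h, hx⟩ => ⟨inv_mem h, M.neg_mem hx⟩

variable [IsMulCommutative (commutator Q)]

/-- The action of a group on its derived group by conjugation. -/
def conjEnd : Q →* Module.End ℤ (Additive (commutator Q)) where
  toFun g := (MonoidHom.toAdditive (MulAut.conjNormal g).toMonoidHom).toIntLinearMap
  map_one' := by
    refine LinearMap.ext fun a => ?_
    apply Additive.toMul.injective
    apply Subtype.ext
    change (1 : Q) * _ * 1⁻¹ = _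
    simp
  map_mul' g h := by
    refine LinearMap.ext fun a => ?_
    apply Additive.toMul.injective
    apply Subtype.ext
    change (g * h : Q) * _ * (g * h)⁻¹ = g * (h * _ * h⁻¹) * g⁻¹
    group

theorem coe_conjEnd (g : Q) (a : Additive (commutator Q)) :
    ((conjEnd g a).toMul : Q) = g * (a.toMul : Q) * g⁻¹ := rfl

theorem conjEnd_apply_of_mem {g : Q} (hg : g ∈ commutator Q) : conjEnd g = 1 := by
  refine LinearMap.ext fun a => ?_
  apply Additive.toMul.injective
  apply Subtype.ext
  rw [coe_conjEnd]
  have := congrArg Subtype.val (mul_comm (⟨g, hg⟩ : commutator Q) a.toMul)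
  simp only [Subgroup.coe_mul] at this
  rw [this, mul_inv_cancel_right]
  rfl

theorem conjEnd_comm (g h : Q) : conjEnd g * conjEnd h = conjEnd h * conjEnd g := by
  have hc : ⁅g, h⁆ ∈ commutator Q :=
    Subgroup.commutator_mem_commutator (Subgroup.mem_top _) (Subgroup.mem_top _)
  rw [← map_mul, ← map_mul, show g * h = ⁅g, h⁆ * (h * g) by rw [commutatorElement_def]; group,
    map_mul, conjEnd_apply_of_mem hc, one_mul]

/-- An invariant `M` corresponds to a normal subgroup. This yields finite generation of the derived
group as a module, by the commutators of the generators. -/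
theorem le_commutator_liftCommutator {s : Set Q} (hs : Subgroup.closure s = ⊤)
    {M : AddSubgroup (Additive (commutator Q))}
    (hM : ∀ g : Q, ∀ a ∈ M, conjEnd g a ∈ M)
    (hsM : ∀ a ∈ s, ∀ b ∈ s, ⁅a, b⁆ ∈ liftCommutator M) : M = ⊤ := by
  have hnorm : (liftCommutator M).Normal := by
    refine ⟨fun x ⟨h, hx⟩ g => ⟨Subgroup.Normal.conj_mem inferInstance x h g, hM g _ hx⟩⟩
  have h1 : commutator Q ≤ liftCommutator M := by
    refine (commutator_le_normalClosure_of_closure_eq_top hs).trans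
      (Subgroup.normalClosure_le_normal ?_)
    rintro _ ⟨a, ha, b, hb, rfl⟩
    exact hsM a ha b hb
  rw [eq_top_iff]
  intro a _
  obtain ⟨h, ha⟩ := h1 a.toMul.2
  exact ha

/-- On the derived group, commutation with `g` is multiplication by `-(c g - 1)`, so each further
commutator with `Q₀` gains a factor `I`. -/
theorem exists_lowerCentralSeries_eq_bot {R : Type u} [CommRing R]
    [Module R (Additive (commutator Q))] (c : Q → R)
    (hc : ∀ (g : Q) (a : Additive (commutator Q)), c g • a = conjEnd g a)
    {I : Ideal R} (hI : IsNilpotent I) {Q₀ : Subgroup Q}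
    (hQ₀ : ∀ g ∈ Q₀, c g - 1 ∈ I) : Group.IsNilpotent Q₀ := by
  obtain ⟨n, hn⟩ := hI
  have key : ∀ k, Q₀.lowerCentralSeries (k + 1) ≤
      liftCommutator
        (Submodule.toAddSubgroup (I ^ k • (⊤ : Submodule R (Additive (commutator Q))))) := by
    intro k
    induction k with
    | zero =>
      rw [Subgroup.lowerCentralSeries_succ, Subgroup.commutator_le]
      intro x _ y _
      refine ⟨Subgroup.commutator_mem_commutator (Subgroup.mem_top _) (Subgroup.mem_top _), ?_⟩
      rw [pow_zero, Ideal.one_eq_top, Submodule.top_smul]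
      exact AddSubgroup.mem_top _
    | succ k ih =>
      rw [Subgroup.lowerCentralSeries_succ, Subgroup.commutator_le]
      intro x hx g hg
      obtain ⟨hxc, hx⟩ := ih hx
      refine ⟨Subgroup.commutator_mem_commutator (Subgroup.mem_top _) (Subgroup.mem_top _), ?_⟩
      have : Additive.ofMul (⟨⁅x, g⁆, Subgroup.commutator_mem_commutator (Subgroup.mem_top _)
          (Subgroup.mem_top _)⟩ : commutator Q) =
          -((c g - 1) • Additive.ofMul (⟨x, hxc⟩ : commutator Q)) := by
        rw [sub_smul, one_smul, neg_sub, hc, sub_eq_add_neg, ← map_neg]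
        apply Additive.toMul.injective
        apply Subtype.ext
        change x * g * x⁻¹ * g⁻¹ = x * (g * x⁻¹ * g⁻¹)
        group
      rw [this, Submodule.mem_toAddSubgroup, pow_succ', mul_smul]
      exact neg_mem (Submodule.smul_mem_smul (hQ₀ g hg) hx)
  refine Subgroup.isNilpotent_of_lowerCentralSeries_eq_bot (n := n + 1) ?_
  rw [eq_bot_iff]
  intro x hx
  obtain ⟨h, hx⟩ := key n hx
  rw [hn, Submodule.mem_toAddSubgroup, Submodule.zero_eq_bot, Submodule.bot_smul,
    Submodule.mem_bot] at hx
  exact congrArg Subtype.val (Additive.ofMul.injective hx)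

theorem coe_sum_conjEnd_pow (g : Q) (a : Additive (commutator Q)) (n : ℕ) :
    (((∑ i ∈ Finset.range n, conjEnd g ^ i) a).toMul : Q) * g ^ n = (a.toMul * g) ^ n := by
  induction n with
  | zero => simp
  | succ n ih =>
    rw [Finset.sum_range_succ, LinearMap.add_apply, pow_succ (_ * g), ← ih, toMul_add,
      Subgroup.coe_mul, ← map_pow, coe_conjEnd, pow_succ]
    group

/-- By `coe_sum_conjEnd_pow`, an element `a` killed by the sum satisfies `(a * g) ^ q = g ^ q`, and
uniqueness of roots cancels `a`. -/
theorem sum_conjEnd_pow_injective {π : Set ℕ} (hU : IsU π Q) {q : ℕ} (hq : q.Prime) (hqπ : q ∉ π)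
    (g : Q) {a : Additive (commutator Q)} (ha : (∑ i ∈ Finset.range q, conjEnd g ^ i) a = 0) :
    a = 0 := by
  have hm : IsPrimeTo π q := ⟨hq.pos, fun p hp h => by
    rwa [(Nat.prime_dvd_prime_iff_eq hp hq).mp h]⟩
  have h := coe_sum_conjEnd_pow g a q
  rw [ha, toMul_zero, Subgroup.coe_one, one_mul] at h
  have := hU q hm h
  apply Additive.toMul.injective
  apply Subtype.ext
  exact mul_eq_right.mp this.symm

/-- The unipotent alternative would make `Q` virtually nilpotent. In the other one, the sum of the
powers of `c g` acts injectively on a faithful module, so it is not a zero divisor, whereas every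
element of a minimal prime is one. -/
theorem exists_affine_character_of_module {π : Set ℕ} (hU : IsU π Q)
    (hnv : ¬ Group.IsVirtuallyNilpotent Q) {R : Type u} [CommRing R] [IsNoetherianRing R]
    [Module R (Additive (commutator Q))] [Module.Finite R (Additive (commutator Q))]
    (hfaith : ∀ r : R, (∀ a : Additive (commutator Q), r • a = 0) → r = 0) (c : Q →* R)
    (hc : ∀ (g : Q) (a : Additive (commutator Q)), c g • a = conjEnd g a) :
    ∃ (K : Type u) (_ : Field K) (_ : IsAlgClosed K) (χ : Q →* K)
      (φ : Additive (commutator Q) →+ K), (∀ g a, φ (conjEnd g a) = χ g * φ a) ∧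
      (∃ a, φ a ≠ 0) ∧ (Set.range χ).Infinite ∧
      ∀ q : ℕ, q.Prime → q ∉ π → ∀ g, ∑ i ∈ Finset.range q, χ g ^ i ≠ 0 := by
  rcases exists_minimalPrimes_or_unipotent c with ⟨p, hp, hpmin, hinf⟩ | ⟨Q₀, hQ₀, h⟩
  · obtain ⟨φ, hφ, a, ha⟩ := exists_functional_residueField hfaith p
    let j := algebraMap p.ResidueField (AlgebraicClosure p.ResidueField)
    have hj : Function.Injective j := j.injective
    refine ⟨AlgebraicClosure p.ResidueField, inferInstance, inferInstance,
      (j.comp (algebraMap R p.ResidueField)).toMonoidHom.comp c, j.toAddMonoidHom.comp φ,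
      ?_, ⟨a, ?_⟩, ?_, ?_⟩
    · intro g a
      change j (φ (conjEnd g a)) = j (algebraMap R _ (c g)) * j (φ a)
      rw [← hc, hφ, map_mul]
    · change j (φ a) ≠ 0
      rwa [map_ne_zero_iff _ hj]
    · intro h
      refine hinf (Set.Finite.of_finite_image (f := j) (h.subset ?_) hj.injOn)
      rintro _ ⟨_, ⟨g, rfl⟩, rfl⟩
      exact ⟨g, rfl⟩
    · intro q hq hqπ g h0
      have h1 : ∑ i ∈ Finset.range q, c g ^ i ∈ p := by
        rw [← Ideal.algebraMap_residueField_eq_zero]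
        apply hj
        rw [map_zero, ← h0, map_sum, map_sum]
        simp only [map_pow]
        rfl
      refine Set.disjoint_left.mp (Ideal.disjoint_nonZeroDivisors_of_mem_minimalPrimes hpmin) h1 ?_
      rw [SetLike.mem_coe, mem_nonZeroDivisors_iff_left]
      intro r hr
      refine hfaith r fun a => sum_conjEnd_pow_injective hU hq hqπ g ?_
      have h2 : (∑ i ∈ Finset.range q, c g ^ i) • (r • a) = 0 := by
        rw [← mul_smul, hr, zero_smul]
      rw [← h2, Finset.sum_smul, LinearMap.sum_apply]
      refine Finset.sum_congr rfl fun i _ => ?_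
      rw [← map_pow, ← map_pow, hc]
  · exact absurd ⟨Q₀, exists_lowerCentralSeries_eq_bot c hc
      (IsNoetherianRing.isNilpotent_nilradical R) h, hQ₀⟩ hnv

/-- A finitely generated metabelian group with unique roots that is not virtually nilpotent has a
nontrivial affine representation of dimension one, over a field, with an infinite linear part. -/
theorem exists_affine_character {π : Set ℕ} (hfg : Group.FG Q) (hU : IsU π Q)
    (hnv : ¬ Group.IsVirtuallyNilpotent Q) :
    ∃ (K : Type u) (_ : Field K) (_ : IsAlgClosed K) (χ : Q →* K)
      (φ : Additive (commutator Q) →+ K), (∀ g a, φ (conjEnd g a) = χ g * φ a) ∧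
      (∃ a, φ a ≠ 0) ∧ (Set.range χ).Infinite ∧
      ∀ q : ℕ, q.Prime → q ∉ π → ∀ g, ∑ i ∈ Finset.range q, χ g ^ i ≠ 0 := by
  set R := Algebra.adjoin ℤ (Set.range (conjEnd (Q := Q))) with hR
  have hcomm : IsMulCommutative R := by
    apply Algebra.isMulCommutative_adjoin
    rintro _ ⟨g, rfl⟩ _ ⟨h, rfl⟩
    exact conjEnd_comm g h
  let c : Q →* R := (conjEnd (Q := Q)).codRestrict R fun g => Algebra.subset_adjoin ⟨g, rfl⟩
  have hc : ∀ g a, c g • a = conjEnd g a := fun g a => rfl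
  have hft : Algebra.FiniteType ℤ R := by
    rw [← Subalgebra.fg_iff_finiteType]
    obtain ⟨s, hs⟩ := Group.fg_iff_monoid_fg.mp hfg
    classical
    refine ⟨s.image conjEnd, le_antisymm ?_ ?_⟩
    · refine Algebra.adjoin_mono ?_
      rw [Finset.coe_image]
      exact Set.image_subset_range _ _
    · refine Algebra.adjoin_le ?_
      rintro _ ⟨g, rfl⟩
      have : (⊤ : Submonoid Q) ≤ ((Algebra.adjoin ℤ
          ((s.image (conjEnd (Q := Q)) : Finset _) : Set _)).toSubmonoid).comap conjEnd := by
        rw [← hs, Submonoid.closure_le]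
        intro x hx
        exact Algebra.subset_adjoin (by simpa using ⟨x, hx, rfl⟩)
      exact this (Submonoid.mem_top g)
  have hnoeth : IsNoetherianRing R := Algebra.FiniteType.isNoetherianRing ℤ R
  have hfin : Module.Finite R (Additive (commutator Q)) := by
    obtain ⟨s, hs⟩ := hfg
    let F : Set (Additive (commutator Q)) :=
      {x | ∃ a ∈ s, ∃ b ∈ s, ⁅a, b⁆ = (x.toMul : Q)}
    have hF : F.Finite := by
      refine Set.Finite.of_finite_image (f := fun x => (x.toMul : Q)) ?_
        (Subtype.val_injective.comp Additive.toMul.injective).injOn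
      refine ((s.finite_toSet.prod s.finite_toSet).image fun x => ⁅x.1, x.2⁆).subset ?_
      rintro _ ⟨x, ⟨a, ha, b, hb, h⟩, rfl⟩
      exact ⟨(a, b), ⟨ha, hb⟩, h⟩
    refine ⟨(Submodule.fg_def).mpr ⟨F, hF, ?_⟩⟩
    have := le_commutator_liftCommutator hs (M := (Submodule.span R F).toAddSubgroup)
      (fun g a ha => by
        rw [← hc]
        exact Submodule.smul_mem _ _ ha)
      (fun a ha b hb => ⟨Subgroup.commutator_mem_commutator (Subgroup.mem_top _)
        (Subgroup.mem_top _), Submodule.subset_span ⟨a, ha, b, hb, rfl⟩⟩)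
    rw [eq_top_iff]
    intro x _
    rw [← Submodule.mem_toAddSubgroup, this]
    trivial
  have hfaith : ∀ r : R, (∀ a : Additive (commutator Q), r • a = 0) → r = 0 := fun r h =>
    Subtype.ext (LinearMap.ext h)
  exact exists_affine_character_of_module hU hnv hfaith c hc

end Conjugation

/-! ### A divisible torus with an extra torsion character. -/

section Torus

/-- The units of an algebraically closed field form a divisible group, which is injective among
abelian groups. -/
theorem exists_hom_units_extension {K A B : Type*} [Field K] [IsAlgClosed K] [CommGroup A]
    [CommGroup B] (f : A →* B) (hf : Function.Injective f) (g : A →* Kˣ) :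
    ∃ h : B →* Kˣ, ∀ a, h (f a) = g a := by
  classical
  have hroot : ∀ (x : Kˣ) (n : ℕ), n ≠ 0 → ∃ y : Kˣ, y ^ n = x := by
    intro x n hn
    obtain ⟨z, hz⟩ := IsAlgClosed.exists_pow_nat_eq (x : K) (Nat.pos_of_ne_zero hn)
    have hz0 : z ≠ 0 := by
      rintro rfl
      rw [zero_pow hn] at hz
      exact x.ne_zero hz.symm
    exact ⟨Units.mk0 z hz0, Units.ext (by simpa using hz)⟩
  let : DivisibleBy (Additive Kˣ) ℕ :=
    { div := fun a n => if h : n = 0 then 0 else Additive.ofMul (hroot a.toMul n h).choose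
      div_zero := fun a => dif_pos rfl
      div_cancel := fun {n} a hn => by
        rw [dif_neg hn]
        exact congrArg Additive.ofMul (hroot a.toMul n hn).choose_spec }
  let : DivisibleBy (Additive Kˣ) ℤ := AddGroup.divisibleByIntOfDivisibleByNat _
  obtain ⟨h, hh⟩ := (Module.Baer.of_divisible (Additive Kˣ)).extension_property_addMonoidHom
    (MonoidHom.toAdditive f) (fun a b h => hf h) (MonoidHom.toAdditive g)
  exact ⟨MonoidHom.toAdditive.symm h, fun a => DFunLike.congr_fun hh a⟩

/-- The embedding of a free abelian group in its divisible hull. -/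
def intToRat (j : Type) : (j → Multiplicative ℤ) →* (j → Multiplicative ℚ) where
  toFun v i := Multiplicative.ofAdd ((v i).toAdd : ℚ)
  map_one' := by
    ext i
    change ((0 : ℤ) : ℚ) = 0
    simp
  map_mul' v w := by
    ext i
    change (((v i).toAdd + (w i).toAdd : ℤ) : ℚ) = _
    push_cast
    rfl

theorem intToRat_injective (j : Type) : Function.Injective (intToRat j) := by
  intro v w h
  funext i
  have := congrFun h i
  exact Int.cast_injective (α := ℚ) this

theorem exists_pow_eq_intToRat {j : Type} [Fintype j] (v : j → Multiplicative ℚ) :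
    ∃ n : ℕ, 0 < n ∧ ∃ w, v ^ n = intToRat j w := by
  refine ⟨∏ i, (v i).toAdd.den, Finset.prod_pos fun i _ => Rat.den_pos _, ?_⟩
  have : ∀ i, ∃ w : ℤ, ((∏ k, (v k).toAdd.den : ℕ) : ℚ) * (v i).toAdd = w := by
    intro i
    obtain ⟨c, hc⟩ := Finset.dvd_prod_of_mem (fun k => (v k).toAdd.den) (Finset.mem_univ i)
    refine ⟨c * (v i).toAdd.num, ?_⟩
    rw [hc]
    push_cast
    rw [mul_comm ((v i).toAdd.den : ℚ), mul_assoc, Rat.den_mul_eq_num]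
  choose w hw using this
  refine ⟨fun i => Multiplicative.ofAdd (w i), ?_⟩
  funext i
  apply Multiplicative.toAdd.injective
  change (_ : ℕ) • (v i).toAdd = (w i : ℚ)
  rw [nsmul_eq_mul, hw]

theorem rat_pow_bijective (j : Type) {q : ℕ} (hq : q ≠ 0) :
    Function.Bijective fun v : j → Multiplicative ℚ => v ^ q := by
  have hq' : (q : ℚ) ≠ 0 := Nat.cast_ne_zero.mpr hq
  constructor
  · intro v w h
    funext i
    apply Multiplicative.toAdd.injective
    have h1 : q • (v i).toAdd = q • (w i).toAdd := congrFun h i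
    rw [nsmul_eq_mul, nsmul_eq_mul] at h1
    exact mul_left_cancel₀ hq' h1
  · intro v
    refine ⟨fun i => Multiplicative.ofAdd ((v i).toAdd / q), ?_⟩
    funext i
    apply Multiplicative.toAdd.injective
    change q • ((v i).toAdd / q) = (v i).toAdd
    rw [nsmul_eq_mul, mul_div_cancel₀ _ hq']

theorem exists_odd_prime_notMem {π : Set ℕ} (hπ : π.Finite) :
    ∃ q : ℕ, q.Prime ∧ q ∉ π ∧ 3 ≤ q := by
  obtain ⟨q, hq, hq'⟩ := (Nat.infinite_setOfPred_prime.sdiff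
    (hπ.union (Set.finite_le_nat 2))).nonempty
  simp only [Set.mem_union, Set.mem_ofPred_eq, not_or, not_le] at hq'
  exact ⟨q, hq, hq'.1, hq'.2⟩

/-- The characters of a rational vector space that are trivial on the lattice and send a given
fraction of a basis vector to a primitive root of unity. -/
theorem exists_torsion_character {K : Type*} [Field K] [IsAlgClosed K] {q : ℕ}
    (hq : (q : K) ≠ 0) : ∃ ψ : Multiplicative ℚ →* Kˣ,
      (∀ n : ℤ, ψ (Multiplicative.ofAdd (n : ℚ)) = 1) ∧
      IsPrimitiveRoot (ψ (Multiplicative.ofAdd (1 / q : ℚ)) : K) q := by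
  have : NeZero (q : K) := ⟨hq⟩
  have hq0 : (q : ℚ) ≠ 0 := by
    rintro h
    rw [Nat.cast_eq_zero] at h
    simp [h] at hq
  obtain ⟨z, hz⟩ := HasEnoughRootsOfUnity.exists_primitiveRoot K q
  have hz0 : z ≠ 0 := hz.ne_zero (by rintro rfl; simp at hq)
  let f : Multiplicative ℤ →* Multiplicative ℚ := zpowersHom _ (Multiplicative.ofAdd (1 / q : ℚ))
  have hf : ∀ n : ℤ, (f (Multiplicative.ofAdd n)).toAdd = n * (1 / q) := fun n => by
    change n • (1 / q : ℚ) = _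
    rw [zsmul_eq_mul]
  have hinj : Function.Injective f := by
    intro a b h
    have h1 := hf a.toAdd
    have h2 := hf b.toAdd
    rw [ofAdd_toAdd] at h1 h2
    rw [h, h2] at h1
    have := mul_right_cancel₀ (one_div_ne_zero hq0) h1
    exact (Int.cast_injective this).symm
  obtain ⟨ψ, hψ⟩ := exists_hom_units_extension f hinj (zpowersHom _ (Units.mk0 z hz0))
  refine ⟨ψ, fun n => ?_, ?_⟩
  · have : f (Multiplicative.ofAdd (n * q)) = Multiplicative.ofAdd (n : ℚ) := by
      apply Multiplicative.toAdd.injective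
      rw [hf]
      push_cast
      rw [toAdd_ofAdd, mul_assoc, mul_one_div_cancel hq0, mul_one]
    rw [← this, hψ, zpowersHom_apply, toAdd_ofAdd, mul_comm, zpow_mul]
    have : Units.mk0 z hz0 ^ (q : ℤ) = 1 := by
      rw [zpow_natCast]
      exact Units.ext (by simpa using hz.pow_eq_one)
    rw [this, one_zpow]
  · have : f (Multiplicative.ofAdd 1) = Multiplicative.ofAdd (1 / q : ℚ) := by
      apply Multiplicative.toAdd.injective
      rw [hf]
      simp
    rw [← this, hψ, zpowersHom_apply]
    simpa using hz

theorem torsion_character_pow {K : Type*} [Field K] {ψ : Multiplicative ℚ →* Kˣ}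
    (hψ : ∀ n : ℤ, ψ (Multiplicative.ofAdd (n : ℚ)) = 1) (x : Multiplicative ℚ) :
    ψ x ^ x.toAdd.den = 1 := by
  rw [← map_pow, ← hψ x.toAdd.num]
  congr 1
  apply Multiplicative.toAdd.injective
  change (_ : ℕ) • x.toAdd = (x.toAdd.num : ℚ)
  rw [nsmul_eq_mul, Rat.den_mul_eq_num]

/-- A character of a finitely generated group extends to an abelian local group, along with a second
character that is trivial on the given group and takes torsion values. -/
theorem exists_torus {π : Set ℕ} (hπ : π.Finite) {Q K : Type u} [Group Q] (hfg : Group.FG Q)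
    [Field K] [IsAlgClosed K] (χ : Q →* K) (hinf : (Set.range χ).Infinite)
    (hχ : ∀ q : ℕ, q.Prime → q ∉ π → ∀ g, ∑ i ∈ Finset.range q, χ g ^ i ≠ 0) :
    ∃ (T : Type) (_ : CommGroup T) (τ : Q →* T) (X Z : T →* Kˣ) (t : Q) (s : T) (q : ℕ),
      IsLocal π T ∧ (∀ g, (X (τ g) : K) = χ g) ∧ (∀ g, Z (τ g) = 1) ∧ q.Prime ∧ q ∉ π ∧
      s ^ q = τ t ∧ χ t ≠ 1 ∧ (Z s : K) ≠ 1 ∧ (Z s : K) ^ 2 ≠ 1 ∧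
      ∀ (x : T) (n : ℕ) (e : ℤ) (r : ℕ), n ≠ 0 → r.Prime → r ∉ π →
        ∑ i ∈ Finset.range r, ((X x ^ n * Z x ^ e : Kˣ) : K) ^ i ≠ 0 := by
  obtain ⟨q, hq, hqπ, hq3⟩ := exists_odd_prime_notMem hπ
  let U : Q →* Kˣ := χ.toHomUnits
  have hU : ∀ g, (U g : K) = χ g := fun g => rfl
  have hfgU : Group.FG U.range := Group.fg_range U
  obtain ⟨ι, j, hι, hj, p, hp, e, ⟨E⟩⟩ := CommGroup.equiv_free_prod_prod_multiplicative_zmod U.range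
  have hne : ∀ i, NeZero (p i ^ e i) := fun i => ⟨pow_ne_zero _ (hp i).ne_zero⟩
  set F := (i : ι) → Multiplicative (ZMod (p i ^ e i)) with hF
  have hFfin : Finite F := by
    have : ∀ i, Finite (Multiplicative (ZMod (p i ^ e i))) := fun i =>
      inferInstanceAs (Finite (ZMod (p i ^ e i)))
    infer_instance
  -- no torsion outside `π`
  have htors : ∀ r : ℕ, r.Prime → r ∉ π → ∀ g, χ g ^ r = 1 → χ g = 1 := by
    intro r hr hrπ g hg
    have := geom_sum_mul (χ g) r
    rw [hg, sub_self] at this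
    exact sub_eq_zero.mp ((mul_eq_zero.mp this).resolve_left (hχ r hr hrπ g))
  obtain ⟨X', hX'⟩ := exists_hom_units_extension (intToRat j) (intToRat_injective j)
    (U.range.subtype.comp (E.symm.toMonoidHom.comp (MonoidHom.inl _ F)))
  let XF : F →* Kˣ := U.range.subtype.comp (E.symm.toMonoidHom.comp (MonoidHom.inr _ F))
  have hXF : Function.Injective XF := by
    intro a b h
    have := E.symm.injective (Subtype.ext h)
    exact congrArg Prod.snd this
  -- At `g = 1` the sum of powers is `q`, so the characteristic is not `q`.
  have hqK : (q : K) ≠ 0 := by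
    have := hχ q hq hqπ 1
    simpa using this
  obtain ⟨ψ, hψ1, hψ⟩ := exists_torsion_character hqK
  have hj0 : Nonempty j := by
    by_contra hempty
    rw [not_nonempty_iff] at hempty
    have h1 : Finite U.range := Finite.of_equiv _ E.symm.toEquiv
    refine hinf ((Set.toFinite (Set.range fun x : U.range => ((x : Kˣ) : K))).subset ?_)
    rintro _ ⟨g, rfl⟩
    exact ⟨⟨U g, g, rfl⟩, rfl⟩
  obtain ⟨j0⟩ := hj0
  classical
  let ψ' : (j → Multiplicative ℚ) →* Kˣ := ψ.comp (Pi.evalMonoidHom _ j0)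
  let T := (j → Multiplicative ℚ) × F
  let X : T →* Kˣ := X'.coprod XF
  let Z : T →* Kˣ := ψ'.comp (MonoidHom.fst _ _)
  let τ : Q →* T := ((intToRat j).prodMap (MonoidHom.id F)).comp
    (E.toMonoidHom.comp U.rangeRestrict)
  have hXE : ∀ b : (j → Multiplicative ℤ) × F, X (intToRat j b.1, b.2) = (E.symm b : Kˣ) := by
    intro b
    change X' (intToRat j b.1) * XF b.2 = _
    rw [hX']
    change ((E.symm (b.1, 1) * E.symm (1, b.2) : U.range) : Kˣ) = _
    rw [← map_mul]
    simp
  have hXτ : ∀ g, (X (τ g) : K) = χ g := by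
    intro g
    have := hXE (E (U.rangeRestrict g))
    rw [E.symm_apply_apply] at this
    exact congrArg Units.val this
  -- A suitable power of `x` clears denominators and kills the `F` part; on the resulting lattice
  -- `X` is injective, and the rational part has no torsion.
  have hXtors : ∀ (x : T) (n : ℕ), n ≠ 0 → X x ^ n = 1 → x.1 = 1 := by
    intro x n hn hx
    obtain ⟨m, hm, w, hw⟩ := exists_pow_eq_intToRat x.1
    have hc := Nat.card_pos (α := F)
    have h1 : X (intToRat j (w ^ (Nat.card F * n)), 1) = 1 := by
      have h2 : x ^ (m * (Nat.card F * n)) = (intToRat j (w ^ (Nat.card F * n)), 1) := by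
        refine Prod.ext ?_ ?_
        · rw [Prod.pow_fst, pow_mul, hw, map_pow]
        · rw [Prod.pow_snd, mul_comm, mul_assoc, pow_mul, pow_card_eq_one', one_pow]
      rw [← h2, map_pow, ← mul_assoc, mul_comm, pow_mul, hx, one_pow]
    have h3 := hXE (w ^ (Nat.card F * n), 1)
    rw [h1] at h3
    have h4 : E.symm (w ^ (Nat.card F * n), 1) = 1 := Subtype.ext h3.symm
    rw [EmbeddingLike.map_eq_one_iff] at h4
    have h5 : w ^ (Nat.card F * n) = 1 := congrArg Prod.fst h4
    have h6 : x.1 ^ (m * (Nat.card F * n)) = 1 := by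
      rw [pow_mul, hw, ← map_pow, h5, map_one]
    apply (rat_pow_bijective j (q := m * (Nat.card F * n)) (by positivity)).1
    simpa using h6
  have hFX : ∀ f : F, ∃ g, (X (1, f) : K) = χ g := by
    intro f
    obtain ⟨g, hg⟩ := (E.symm (1, f)).2
    refine ⟨g, ?_⟩
    have := hXE (1, f)
    rw [map_one] at this
    rw [this, ← hg, hU]
  -- The element `t` will be a preimage of this basis vector, and `s₀` is its `q`-th part, where `Z`
  -- is a primitive `q`-th root of unity.
  let w₀ : j → Multiplicative ℤ := Pi.mulSingle j0 (Multiplicative.ofAdd 1)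
  let s₀ : j → Multiplicative ℚ := Pi.mulSingle j0 (Multiplicative.ofAdd (1 / q : ℚ))
  have hw₀ : w₀ j0 = Multiplicative.ofAdd 1 := Pi.mulSingle_eq_same _ _
  have hs₀ : s₀ j0 = Multiplicative.ofAdd (1 / q : ℚ) := Pi.mulSingle_eq_same _ _
  let t' : (j → Multiplicative ℤ) × F := (w₀, 1)
  obtain ⟨t, ht⟩ := (E.symm t').2
  have hτt : τ t = (intToRat j t'.1, t'.2) := by
    have : U.rangeRestrict t = E.symm t' := Subtype.ext ht
    change (intToRat j (E (U.rangeRestrict t)).1, (E (U.rangeRestrict t)).2) = _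
    rw [this, E.apply_symm_apply]
  refine ⟨T, inferInstance, τ, X, Z, t,
    (s₀, 1), q, ?_, hXτ, ?_, hq, hqπ, ?_, ?_, ?_,
    ?_, ?_⟩
  · intro r hr hrπ
    have hb : Function.Bijective fun f : F => f ^ r := by
      rw [← Finite.injective_iff_bijective]
      have : Function.Injective (powMonoidHom r : F →* F) := by
        rw [injective_iff_map_eq_one]
        intro f hf
        obtain ⟨g, hg⟩ := hFX f
        apply hXF
        apply Units.ext
        have hXf : X (1, f) = XF f := by
          change X' 1 * XF f = _
          rw [map_one, one_mul]
        rw [map_one, Units.val_one, ← hXf, hg]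
        apply htors r hr hrπ
        rw [← hg, hXf, ← Units.val_pow_eq_pow_val, ← map_pow]
        rw [powMonoidHom_apply] at hf
        rw [hf, map_one, Units.val_one]
      exact this
    exact (rat_pow_bijective j hr.ne_zero).prodMap hb
  · intro g
    change ψ (Multiplicative.ofAdd _) = 1
    exact hψ1 _
  · rw [hτt]
    refine Prod.ext ?_ (one_pow _)
    funext i
    rw [Prod.pow_fst, Pi.pow_apply]
    apply Multiplicative.toAdd.injective
    change q • (s₀ i).toAdd = ((w₀ i).toAdd : ℚ)
    by_cases hi : i = j0
    · rw [hi, hs₀, hw₀, toAdd_ofAdd, toAdd_ofAdd, nsmul_eq_mul,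
        mul_one_div_cancel (Nat.cast_ne_zero.mpr hq.ne_zero), Int.cast_one]
    · rw [show s₀ i = 1 from Pi.mulSingle_eq_of_ne hi _, show w₀ i = 1 from
        Pi.mulSingle_eq_of_ne hi _, toAdd_one, toAdd_one, Int.cast_zero, smul_zero]
  · intro h1
    have h2 : X (τ t) ^ 1 = 1 := by
      rw [pow_one]
      exact Units.ext ((hXτ t).trans h1)
    have h3 := hXtors _ 1 one_ne_zero h2
    rw [hτt] at h3
    have h4 := congrFun (intToRat_injective j (h3.trans (map_one _).symm)) j0
    rw [show t'.1 j0 = _ from hw₀] at h4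
    exact absurd (congrArg Multiplicative.toAdd h4) one_ne_zero
  · rw [show Z (s₀, 1) = ψ (s₀ j0) from rfl, hs₀]
    exact hψ.ne_one (by omega)
  · rw [show Z (s₀, 1) = ψ (s₀ j0) from rfl, hs₀]
    intro h
    have := Nat.le_of_dvd two_pos (hψ.dvd_of_pow_eq_one 2 h)
    omega
  -- A vanishing sum makes `X x ^ n * Z x ^ k` torsion. Since `Z` is torsion valued, `X x` is
  -- torsion too, so `x` lies in `F`; there `Z` is trivial and `X` takes values of `χ`, contrary to
  -- `hχ`.
  · intro x n k r hn hr hrπ h0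
    have h1 : (X x ^ n * Z x ^ k) ^ r = 1 := by
      have := geom_sum_mul ((X x ^ n * Z x ^ k : Kˣ) : K) r
      rw [h0, zero_mul] at this
      apply Units.ext
      rw [Units.val_pow_eq_pow_val, Units.val_one]
      exact sub_eq_zero.mp this.symm
    have hZ : Z x ^ (x.1 j0).toAdd.den = 1 := torsion_character_pow hψ1 _
    have h2 : x.1 = 1 := by
      refine hXtors x (n * r * (x.1 j0).toAdd.den) (mul_ne_zero (mul_ne_zero hn hr.ne_zero)
        (Rat.den_ne_zero _)) ?_
      have hZk : (Z x ^ k) ^ (x.1 j0).toAdd.den = 1 := by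
        rw [← zpow_natCast, ← zpow_mul, mul_comm, zpow_mul, zpow_natCast, hZ, one_zpow]
      calc X x ^ (n * r * (x.1 j0).toAdd.den)
          = ((X x ^ n * Z x ^ k) ^ r) ^ (x.1 j0).toAdd.den := by
            rw [← pow_mul, mul_comm r, pow_mul (_ * _), mul_pow, hZk, mul_one, ← pow_mul,
              ← pow_mul]
            ring_nf
        _ = 1 := by rw [h1, one_pow]
    have hx : x = (1, x.2) := Prod.ext h2 rfl
    have hZ1 : Z x = 1 := by
      change ψ (x.1 j0) = 1
      rw [h2]
      exact map_one ψ
    obtain ⟨g, hg⟩ := hFX x.2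
    rw [← hx] at hg
    rw [hZ1, one_zpow, mul_one, Units.val_pow_eq_pow_val, hg, ← map_pow] at h0
    exact hχ r hr hrπ _ h0

end Torus

/-! ### Triangular maps on power series with constant term one. -/

section Triangular

open PowerSeries

variable {E : Type*} [Ring E]

theorem coeff_zero_mul_eq (a b : PowerSeries E) : coeff 0 (a * b) = coeff 0 a * coeff 0 b := by
  rw [coeff_zero_eq_constantCoeff, map_mul]

/-- Only the two extreme products involve the coefficients of index `n`, and their other factor is
`1`. -/
theorem coeff_mul_sub_coeff_mul {n : ℕ} (hn : n ≠ 0) {a a' b b' : PowerSeries E}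
    (ha : ∀ k < n, coeff k a = coeff k a') (hb : ∀ k < n, coeff k b = coeff k b')
    (ha0 : coeff 0 a = 1) (hb0 : coeff 0 b = 1) :
    coeff n (a * b) - coeff n (a' * b') =
      (coeff n a - coeff n a') + (coeff n b - coeff n b') := by
  have hpos := Nat.pos_of_ne_zero hn
  rw [coeff_mul, coeff_mul, ← Finset.sum_sub_distrib,
    Finset.sum_eq_add_of_mem (n, 0) (0, n) (by simp) (by simp) (by simp [hn])]
  · simp only [← ha 0 hpos, ← hb 0 hpos, ha0, hb0, mul_one, one_mul]
  · rintro ⟨i, j⟩ hij ⟨h1, h2⟩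
    rw [Finset.HasAntidiagonal.mem_antidiagonal] at hij
    simp only [ne_eq, Prod.mk.injEq, not_and] at h1 h2
    have hi : i < n := by
      rcases eq_or_ne i n with rfl | h
      · exact absurd (by omega) (h1 rfl)
      · omega
    have hj : j < n := by
      rcases eq_or_ne j n with rfl | h
      · exact absurd rfl (h2 (by omega))
      · omega
    rw [ha i hi, hb j hj, sub_self]

theorem coeff_mul_congr {n : ℕ} {a a' b b' : PowerSeries E}
    (ha : ∀ k < n, coeff k a = coeff k a') (hb : ∀ k < n, coeff k b = coeff k b') :
    ∀ k < n, coeff k (a * b) = coeff k (a' * b') := by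
  intro k hk
  rw [coeff_mul, coeff_mul]
  refine Finset.sum_congr rfl ?_
  rintro ⟨i, j⟩ hij
  rw [Finset.HasAntidiagonal.mem_antidiagonal] at hij
  rw [ha i (by dsimp at hij ⊢; omega), hb j (by dsimp at hij ⊢; omega)]

variable {P : PowerSeries E → PowerSeries E} {L : ℕ → E →+ E}

theorem triangular_injective
    (hP : ∀ n ≠ 0, ∀ f g : PowerSeries E, coeff 0 f = 1 → coeff 0 g = 1 →
      (∀ k < n, coeff k f = coeff k g) →
      coeff n (P f) - coeff n (P g) = L n (coeff n f - coeff n g))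
    (hL : ∀ n ≠ 0, Function.Injective (L n)) {f g : PowerSeries E} (hf : coeff 0 f = 1)
    (hg : coeff 0 g = 1) (h : P f = P g) : f = g := by
  ext n
  induction n using Nat.strong_induction_on with
  | _ n ih =>
    rcases eq_or_ne n 0 with rfl | hn
    · rw [hf, hg]
    · have := hP n hn f g hf hg ih
      rw [h, sub_self] at this
      exact sub_eq_zero.mp ((injective_iff_map_eq_zero _).mp (hL n hn) _ this.symm)

/-- The equation is solved one coefficient at a time: correcting coefficient `n + 1` through `L (n +
1)` disturbs nothing below it. -/
theorem triangular_surjective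
    (hP0 : ∀ f : PowerSeries E, coeff 0 f = 1 → coeff 0 (P f) = 1)
    (hP : ∀ n ≠ 0, ∀ f g : PowerSeries E, coeff 0 f = 1 → coeff 0 g = 1 →
      (∀ k < n, coeff k f = coeff k g) →
      coeff n (P f) - coeff n (P g) = L n (coeff n f - coeff n g))
    (hL : ∀ n ≠ 0, Function.Surjective (L n)) {h : PowerSeries E} (hh : coeff 0 h = 1) :
    ∃ f, coeff 0 f = 1 ∧ P f = h := by
  have step : ∀ n (f : {f : PowerSeries E // coeff 0 f = 1 ∧ ∀ k ≤ n, coeff k (P f) = coeff k h}),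
      ∃ g : {f : PowerSeries E // coeff 0 f = 1 ∧ ∀ k ≤ n + 1, coeff k (P f) = coeff k h},
        ∀ k ≤ n, coeff k g.1 = coeff k f.1 := by
    rintro n ⟨f, hf, hfk⟩
    obtain ⟨c, hc⟩ := hL (n + 1) n.succ_ne_zero (coeff (n + 1) h - coeff (n + 1) (P f))
    have hcoeff : ∀ k ≤ n, coeff k (f + monomial (n + 1) c) = coeff k f := by
      intro k hk
      rw [map_add, coeff_monomial, if_neg (by omega), add_zero]
    have hg0 : coeff 0 (f + monomial (n + 1) c) = 1 := by rw [hcoeff 0 n.zero_le, hf]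
    refine ⟨⟨f + monomial (n + 1) c, hg0, fun k hk => ?_⟩, hcoeff⟩
    rcases eq_or_ne k 0 with rfl | hk0
    · rw [hP0 _ hg0, hh]
    have hd := hP k hk0 _ _ hg0 hf fun i hi => hcoeff i (by omega)
    rcases Nat.lt_or_ge n k with h1 | h1
    · obtain rfl : k = n + 1 := by omega
      rw [map_add, coeff_monomial, if_pos rfl, add_sub_cancel_left, hc] at hd
      exact sub_left_injective hd
    · rw [hcoeff k h1, sub_self, map_zero, sub_eq_zero] at hd
      rw [hd, hfk k h1]
  choose next hnext using step
  let F : (n : ℕ) → {f : PowerSeries E // coeff 0 f = 1 ∧ ∀ k ≤ n, coeff k (P f) = coeff k h} :=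
    fun n => Nat.rec ⟨1, by simp, fun k hk => by
      obtain rfl : k = 0 := Nat.le_zero.mp hk
      rw [hP0 1 (by simp), hh]⟩ next n
  have hF : ∀ n, F (n + 1) = next n (F n) := fun n => rfl
  have hcoh : ∀ n m, m ≤ n → coeff m (F n).1 = coeff m (F m).1 := by
    intro n
    induction n with
    | zero =>
      intro m hm
      obtain rfl : m = 0 := by omega
      rfl
    | succ n ih =>
      intro m hm
      rcases Nat.lt_or_ge n m with h1 | h1
      · obtain rfl : m = n + 1 := by omega
        rfl
      · rw [hF, hnext n _ m h1, ih m h1]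
  -- The diagonal series agrees with the `n`-th approximation up to degree `n`, by `hcoh`.
  let f : PowerSeries E := PowerSeries.mk fun n => coeff n (F n).1
  have hf : ∀ n, coeff n f = coeff n (F n).1 := fun n => coeff_mk _ _
  have hf0 : coeff 0 f = 1 := by rw [hf, (F 0).2.1]
  refine ⟨f, hf0, ?_⟩
  ext n
  rcases eq_or_ne n 0 with rfl | hn
  · rw [hP0 f hf0, hh]
  have hd := hP n hn f (F n).1 hf0 (F n).2.1 fun k hk => by rw [hf, hcoh n k hk.le]
  rw [hf, sub_self, map_zero, sub_eq_zero] at hd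
  rw [hd, (F n).2.2 n le_rfl]

theorem exists_mul_eq_one {f : PowerSeries E} (hf : coeff 0 f = 1) :
    ∃ g, coeff 0 g = 1 ∧ g * f = 1 := by
  refine triangular_surjective (P := fun g => g * f) (L := fun _ => AddMonoidHom.id E) ?_ ?_ ?_
    (by simp)
  · intro g hg
    rw [coeff_zero_mul_eq, hf, hg, one_mul]
  · intro n hn a b ha hb hab
    rw [coeff_mul_sub_coeff_mul hn hab (fun _ _ => rfl) ha hf, sub_self, add_zero]
    rfl
  · exact fun n _ => Function.surjective_id

end Triangular

/-! ### The `π`-local group of twisted power series. -/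

section Twisted

open PowerSeries

variable {K : Type u} {T : Type v} [Field K] [CommGroup T]

/-- The weight of the torus on an entry of a coefficient. -/
def twistWeight (X Z : T →* Kˣ) (x : T) (n : ℕ) (a b : Fin 2) : K :=
  ((X x ^ n * Z x ^ ((b : ℤ) - (a : ℤ)) : Kˣ) : K)

/-- The torus scales the variable by `X x` and conjugates by the diagonal matrix with entries `1`
and `(Z x)⁻¹`; hence the weights multiply and `twist` respects products. -/
theorem twistWeight_mul (X Z : T →* Kˣ) (x : T) (n m : ℕ) (a b c : Fin 2) :
    twistWeight X Z x n a b * twistWeight X Z x m b c = twistWeight X Z x (n + m) a c := by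
  rw [twistWeight, twistWeight, twistWeight, ← Units.val_mul, mul_mul_mul_comm, ← pow_add,
    ← zpow_add, sub_add_sub_cancel']

theorem twistWeight_comp (X Z : T →* Kˣ) (x y : T) (n : ℕ) (a b : Fin 2) :
    twistWeight X Z (x * y) n a b = twistWeight X Z x n a b * twistWeight X Z y n a b := by
  rw [twistWeight, twistWeight, twistWeight, ← Units.val_mul, map_mul, map_mul, mul_pow, mul_zpow,
    mul_mul_mul_comm]

theorem twistWeight_one (X Z : T →* Kˣ) (n : ℕ) (a b : Fin 2) :
    twistWeight X Z 1 n a b = 1 := by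
  simp [twistWeight]

theorem twistWeight_pow (X Z : T →* Kˣ) (x : T) (i n : ℕ) (a b : Fin 2) :
    twistWeight X Z (x ^ i) n a b = twistWeight X Z x n a b ^ i := by
  induction i with
  | zero => rw [pow_zero, pow_zero, twistWeight_one]
  | succ i ih => rw [pow_succ, twistWeight_comp, ih, pow_succ]

theorem twistWeight_zero_self (X Z : T →* Kˣ) (x : T) (a : Fin 2) :
    twistWeight X Z x 0 a a = 1 := by
  simp [twistWeight]

/-- The action of the torus on power series over the matrix ring. -/
noncomputable def twist (X Z : T →* Kˣ) (x : T) (f : PowerSeries (Matrix (Fin 2) (Fin 2) K)) :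
    PowerSeries (Matrix (Fin 2) (Fin 2) K) :=
  PowerSeries.mk fun n => Matrix.of fun a b => twistWeight X Z x n a b * coeff n f a b

theorem coeff_twist (X Z : T →* Kˣ) (x : T) (f : PowerSeries (Matrix (Fin 2) (Fin 2) K)) (n : ℕ)
    (a b : Fin 2) : coeff n (twist X Z x f) a b = twistWeight X Z x n a b * coeff n f a b := by
  rw [twist, coeff_mk]
  rfl

theorem twist_mul (X Z : T →* Kˣ) (x : T) (f g : PowerSeries (Matrix (Fin 2) (Fin 2) K)) :
    twist X Z x (f * g) = twist X Z x f * twist X Z x g := by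
  ext n a b
  rw [coeff_twist, coeff_mul, coeff_mul, Matrix.sum_apply, Matrix.sum_apply, Finset.mul_sum]
  refine Finset.sum_congr rfl ?_
  rintro ⟨i, j⟩ hij
  rw [Finset.HasAntidiagonal.mem_antidiagonal] at hij
  rw [Matrix.mul_apply, Matrix.mul_apply, Finset.mul_sum]
  refine Finset.sum_congr rfl fun c _ => ?_
  rw [coeff_twist, coeff_twist, ← hij, ← twistWeight_mul X Z x i j a c b]
  ring

theorem coeff_zero_twist (X Z : T →* Kˣ) (x : T) {f : PowerSeries (Matrix (Fin 2) (Fin 2) K)}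
    (hf : coeff 0 f = 1) : coeff 0 (twist X Z x f) = 1 := by
  ext a b
  rw [coeff_twist, hf]
  by_cases hab : a = b
  · rw [hab, twistWeight_zero_self, one_mul]
  · rw [Matrix.one_apply_ne hab, mul_zero]

theorem twist_one_right (X Z : T →* Kˣ) (x : T) : twist X Z x 1 = 1 := by
  ext n a b
  rcases eq_or_ne n 0 with rfl | hn
  · rw [coeff_zero_twist X Z x (by simp), coeff_zero_one]
  · rw [coeff_twist, coeff_one, if_neg hn, Matrix.zero_apply, mul_zero]

theorem twist_twist (X Z : T →* Kˣ) (x y : T) (f : PowerSeries (Matrix (Fin 2) (Fin 2) K)) :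
    twist X Z x (twist X Z y f) = twist X Z (x * y) f := by
  ext n a b
  rw [coeff_twist, coeff_twist, coeff_twist, twistWeight_comp, mul_assoc]

theorem twist_one_left (X Z : T →* Kˣ) (f : PowerSeries (Matrix (Fin 2) (Fin 2) K)) :
    twist X Z 1 f = f := by
  ext n a b
  rw [coeff_twist, twistWeight_one, one_mul]

/-- The semidirect product of the congruence subgroup of power series with constant term `1`
over the matrix ring, and a torus. -/
@[ext]
structure TwistedGroup (X Z : T →* Kˣ) where
  ser : PowerSeries (Matrix (Fin 2) (Fin 2) K)
  coeff_zero : coeff 0 ser = 1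
  torus : T

variable {X Z : T →* Kˣ}

namespace TwistedGroup

noncomputable instance : Mul (TwistedGroup X Z) :=
  ⟨fun g h => ⟨g.ser * twist X Z g.torus h.ser, by
    rw [coeff_zero_mul_eq, g.coeff_zero, coeff_zero_twist X Z _ h.coeff_zero, one_mul],
    g.torus * h.torus⟩⟩

noncomputable instance : One (TwistedGroup X Z) := ⟨⟨1, by simp, 1⟩⟩

noncomputable instance : Inv (TwistedGroup X Z) :=
  ⟨fun g => ⟨twist X Z g.torus⁻¹ (exists_mul_eq_one g.coeff_zero).choose,
    coeff_zero_twist X Z _ (exists_mul_eq_one g.coeff_zero).choose_spec.1, g.torus⁻¹⟩⟩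

theorem mul_ser (g h : TwistedGroup X Z) : (g * h).ser = g.ser * twist X Z g.torus h.ser := rfl

theorem mul_torus (g h : TwistedGroup X Z) : (g * h).torus = g.torus * h.torus := rfl

theorem one_ser : (1 : TwistedGroup X Z).ser = 1 := rfl

theorem one_torus : (1 : TwistedGroup X Z).torus = 1 := rfl

noncomputable instance : Group (TwistedGroup X Z) :=
  Group.ofLeftAxioms
    (fun g h k => by
      ext1
      · rw [mul_ser, mul_ser, mul_ser, mul_ser, mul_torus, twist_mul, twist_twist, mul_assoc]
      · rw [mul_torus, mul_torus, mul_torus, mul_torus, mul_assoc])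
    (fun g => by
      ext1
      · rw [mul_ser, one_ser, one_torus, twist_one_left, one_mul]
      · rw [mul_torus, one_torus, one_mul])
    (fun g => by
      ext1
      · change twist X Z g.torus⁻¹ _ * twist X Z g.torus⁻¹ g.ser = 1
        rw [← twist_mul, (exists_mul_eq_one g.coeff_zero).choose_spec.2, twist_one_right]
      · exact inv_mul_cancel g.torus)

/-- The torus component of a twisted group. -/
def toTorus : TwistedGroup X Z →* T where
  toFun := torus
  map_one' := rfl
  map_mul' _ _ := rfl

end TwistedGroup

/-- The product of `q` successive twists of a power series. -/
noncomputable def twistPow (X Z : T →* Kˣ) (x : T) (f : PowerSeries (Matrix (Fin 2) (Fin 2) K)) :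
    ℕ → PowerSeries (Matrix (Fin 2) (Fin 2) K)
  | 0 => 1
  | q + 1 => twistPow X Z x f q * twist X Z (x ^ q) f

theorem TwistedGroup.pow_torus (g : TwistedGroup X Z) (q : ℕ) : (g ^ q).torus = g.torus ^ q :=
  map_pow toTorus g q

theorem TwistedGroup.pow_ser (g : TwistedGroup X Z) (q : ℕ) :
    (g ^ q).ser = twistPow X Z g.torus g.ser q := by
  induction q with
  | zero => rfl
  | succ q ih => rw [pow_succ, mul_ser, ih, pow_torus]; rfl

theorem coeff_zero_twistPow (x : T) {f : PowerSeries (Matrix (Fin 2) (Fin 2) K)}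
    (hf : coeff 0 f = 1) (q : ℕ) : coeff 0 (twistPow X Z x f q) = 1 := by
  induction q with
  | zero => simp [twistPow]
  | succ q ih => rw [twistPow, coeff_zero_mul_eq, ih, coeff_zero_twist X Z _ hf, one_mul]

/-- The linearization of `twistPow`. -/
def twistNorm (X Z : T →* Kˣ) (x : T) (q n : ℕ) :
    Matrix (Fin 2) (Fin 2) K →+ Matrix (Fin 2) (Fin 2) K where
  toFun m := Matrix.of fun a b => (∑ i ∈ Finset.range q, twistWeight X Z x n a b ^ i) * m a b
  map_zero' := by
    ext a b
    simp
  map_add' m m' := by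
    ext a b
    simp [mul_add]

/-- To first order a product adds the changes of its factors, and the `i`-th twist scales a change
by the `i`-th power of the weight. This gives the geometric sums in `twistNorm`. -/
theorem coeff_twistPow_sub (x : T) (q : ℕ) {n : ℕ} (hn : n ≠ 0)
    {f g : PowerSeries (Matrix (Fin 2) (Fin 2) K)} (hf : coeff 0 f = 1)
    (hfg : ∀ k < n, coeff k f = coeff k g) :
    (∀ k < n, coeff k (twistPow X Z x f q) = coeff k (twistPow X Z x g q)) ∧
    coeff n (twistPow X Z x f q) - coeff n (twistPow X Z x g q) =
      twistNorm X Z x q n (coeff n f - coeff n g) := by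
  have htw : ∀ i, ∀ k < n, coeff k (twist X Z (x ^ i) f) = coeff k (twist X Z (x ^ i) g) := by
    intro i k hk
    ext a b
    rw [coeff_twist, coeff_twist, hfg k hk]
  induction q with
  | zero =>
    refine ⟨fun _ _ => rfl, ?_⟩
    ext a b
    simp [twistPow, twistNorm]
  | succ q ih =>
    refine ⟨coeff_mul_congr ih.1 (htw q), ?_⟩
    rw [twistPow, twistPow, coeff_mul_sub_coeff_mul hn ih.1 (htw q) (coeff_zero_twistPow x hf q)
      (coeff_zero_twist X Z _ hf), ih.2]
    ext a b
    rw [Matrix.add_apply, Matrix.sub_apply, coeff_twist, coeff_twist, twistWeight_pow]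
    simp only [twistNorm, AddMonoidHom.coe_mk, ZeroHom.coe_mk, Matrix.of_apply, Matrix.sub_apply,
      Finset.sum_range_succ]
    ring

theorem twistNorm_bijective {x : T} {q n : ℕ}
    (h : ∀ a b, ∑ i ∈ Finset.range q, twistWeight X Z x n a b ^ i ≠ 0) :
    Function.Bijective (twistNorm X Z x q n) := by
  constructor
  · intro m m' hm
    ext a b
    exact mul_left_cancel₀ (h a b) (congrFun (congrFun hm a) b)
  · intro m
    refine ⟨Matrix.of fun a b => (∑ i ∈ Finset.range q, twistWeight X Z x n a b ^ i)⁻¹ * m a b, ?_⟩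
    ext a b
    exact mul_inv_cancel_left₀ (h a b) _

/-- Once the torus component is fixed, taking `q`-th powers is triangular with diagonal `twistNorm`,
which is invertible because the geometric sums do not vanish. -/
theorem TwistedGroup.isLocal {π : Set ℕ} (hT : IsLocal π T)
    (h : ∀ (x : T) (n : ℕ) (e : ℤ) (r : ℕ), n ≠ 0 → r.Prime → r ∉ π →
        ∑ i ∈ Finset.range r, ((X x ^ n * Z x ^ e : Kˣ) : K) ^ i ≠ 0) :
    IsLocal π (TwistedGroup X Z) := by
  intro q hq hqπ
  have hbij : ∀ (x : T) n, n ≠ 0 → Function.Bijective (twistNorm X Z x q n) := fun x n hn =>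
    twistNorm_bijective fun a b => h x n _ q hn hq hqπ
  constructor
  · intro g g' hgg
    have ht : g.torus = g'.torus := by
      apply (hT q hq hqπ).1
      have := congrArg torus hgg
      simpa only [pow_torus] using this
    have hs : twistPow X Z g.torus g.ser q = twistPow X Z g.torus g'.ser q := by
      have := congrArg ser hgg
      simp only [pow_ser] at this
      rw [this, ht]
    refine TwistedGroup.ext ?_ ht
    exact triangular_injective (P := fun f => twistPow X Z g.torus f q)
      (L := twistNorm X Z g.torus q)
      (fun n hn f f' hf _ hff => (coeff_twistPow_sub g.torus q hn hf hff).2)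
      (fun n hn => (hbij g.torus n hn).1) g.coeff_zero g'.coeff_zero hs
  · intro g
    obtain ⟨x, hx⟩ := (hT q hq hqπ).2 g.torus
    obtain ⟨f, hf, hfP⟩ := triangular_surjective (P := fun f => twistPow X Z x f q)
      (L := twistNorm X Z x q) (fun f hf => coeff_zero_twistPow x hf q)
      (fun n hn f f' hf _ hff => (coeff_twistPow_sub x q hn hf hff).2)
      (fun n hn => (hbij x n hn).2) g.coeff_zero
    refine ⟨⟨f, hf, x⟩, TwistedGroup.ext ?_ ?_⟩
    · rw [pow_ser]
      exact hfP
    · rw [pow_torus]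
      exact hx

end Twisted

/-! ### Insolubility from top coefficients of rank one. -/

section Insoluble

open PowerSeries

variable {K : Type u} [Field K]

/-- The matrices of rank one with column `(a, 1)` and row `(1, -b)`. -/
def rankOne (a b : K) : Matrix (Fin 2) (Fin 2) K := !![a, -(a * b); 1, -b]

/-- The row `(1, -b)` times the column `(c, 1)` is `c - b`, so top coefficients multiply to a
nonzero matrix exactly when the adjacent labels differ. -/
theorem rankOne_mul_rankOne (a b c d : K) :
    rankOne a b * rankOne c d = (c - b) • rankOne a d := by
  ext i j
  fin_cases i <;> fin_cases j <;> simp [rankOne, Matrix.mul_apply, Fin.sum_univ_two] <;> ring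

theorem smul_rankOne_ne_zero {c : K} (hc : c ≠ 0) (a b : K) : c • rankOne a b ≠ 0 := by
  intro h
  have := congrFun (congrFun h 1) 0
  simp [rankOne, hc] at this

/-- A series is a polynomial of degree `n` with top coefficient `m`. -/
def HasTop {E : Type*} [Ring E] (f : PowerSeries E) (n : ℕ) (m : E) : Prop :=
  coeff n f = m ∧ ∀ k, n < k → coeff k f = 0

theorem HasTop.mul {E : Type*} [Ring E] {f g : PowerSeries E} {n n' : ℕ} {m m' : E}
    (hf : HasTop f n m) (hg : HasTop g n' m') : HasTop (f * g) (n + n') (m * m') := by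
  constructor
  · rw [coeff_mul, Finset.sum_eq_single_of_mem (n, n')
      (by rw [Finset.HasAntidiagonal.mem_antidiagonal]), hf.1, hg.1]
    rintro ⟨i, j⟩ hij hne
    rw [Finset.HasAntidiagonal.mem_antidiagonal] at hij
    dsimp only at hij ⊢
    rcases lt_or_ge n i with h | h
    · rw [hf.2 i h, zero_mul]
    · rw [hg.2 j, mul_zero]
      by_contra hj
      exact hne (Prod.ext (by dsimp only; omega) (by dsimp only; omega))
  · intro k hk
    rw [coeff_mul]
    refine Finset.sum_eq_zero ?_
    rintro ⟨i, j⟩ hij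
    rw [Finset.HasAntidiagonal.mem_antidiagonal] at hij
    dsimp only at hij ⊢
    rcases lt_or_ge n i with h | h
    · rw [hf.2 i h, zero_mul]
    · rw [hg.2 j (by omega), mul_zero]

variable {T : Type v} [CommGroup T] {X Z : T →* Kˣ}

/-- Elements without torus component that are polynomials of positive degree with top coefficient
proportional to `rankOne a b`. -/
def HasEnds (g : TwistedGroup X Z) (a b : K) : Prop :=
  g.torus = 1 ∧ ∃ n : ℕ, 0 < n ∧ ∃ c : K, c ≠ 0 ∧ HasTop g.ser n (c • rankOne a b)

theorem HasEnds.mul {g h : TwistedGroup X Z} {a b c d : K} (hg : HasEnds g a b)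
    (hh : HasEnds h c d) (hbc : b ≠ c) : HasEnds (g * h) a d := by
  obtain ⟨hgt, n, hn, x, hx, htop⟩ := hg
  obtain ⟨hht, m, hm, y, hy, htop'⟩ := hh
  refine ⟨by rw [TwistedGroup.mul_torus, hgt, hht, one_mul], n + m, by omega,
    x * y * (c - b), mul_ne_zero (mul_ne_zero hx hy) (sub_ne_zero.mpr hbc.symm), ?_⟩
  have := htop.mul htop'
  rw [smul_mul_smul_comm, rankOne_mul_rankOne, smul_smul] at this
  rwa [TwistedGroup.mul_ser, hgt, twist_one_left]

theorem HasEnds.ne_one {g : TwistedGroup X Z} {a b : K} (hg : HasEnds g a b) : g ≠ 1 := by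
  rintro rfl
  obtain ⟨-, n, hn, x, hx, htop, -⟩ := hg
  rw [TwistedGroup.one_ser, coeff_one, if_neg hn.ne'] at htop
  exact smul_rankOne_ne_zero hx a b htop.symm

/-- A set of elements of all end types that is closed under inversion of types. -/
def HasAllEnds (z : Fin 3 → K) (S : Subgroup (TwistedGroup X Z)) : Prop :=
  ∀ i j, ∃ g ∈ S, HasEnds g (z i) (z j) ∧ HasEnds g⁻¹ (z j) (z i)

theorem HasAllEnds.commutator {z : Fin 3 → K} (hz : Function.Injective z)
    {S : Subgroup (TwistedGroup X Z)} (hS : HasAllEnds z S) : HasAllEnds z ⁅S, S⁆ := by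
  intro i k
  -- These inequalities separate all junctions in the words for `⁅g, h⁆` and its inverse. With two
  -- labels the choice would fail for `i = k`.
  obtain ⟨l, j, hli, hjk, hjl⟩ : ∃ l j : Fin 3, l ≠ i ∧ j ≠ k ∧ j ≠ l := by
    revert i k
    decide
  obtain ⟨g, hg, hg1, hg2⟩ := hS i j
  obtain ⟨h, hh, hh1, hh2⟩ := hS k l
  refine ⟨⁅g, h⁆, Subgroup.commutator_mem_commutator hg hh, ?_, ?_⟩
  · rw [commutatorElement_def]
    exact ((hg1.mul hh1 (hz.ne hjk)).mul hg2 (hz.ne hjl.symm)).mul hh2 (hz.ne hli.symm)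
  · rw [commutatorElement_inv, commutatorElement_def]
    exact ((hh1.mul hg1 (hz.ne hli)).mul hh2 (hz.ne hjl)).mul hg2 (hz.ne hjk.symm)

theorem not_isSolvable_of_hasAllEnds {z : Fin 3 → K} (hz : Function.Injective z) {L : Type*}
    [Group L] (θ : L →* TwistedGroup X Z) (h : HasAllEnds z θ.range) :
    ¬ Group.IsSolvable L := by
  rintro ⟨n, hn⟩
  have key : ∀ k, HasAllEnds z ((derivedSeries L k).map θ) := by
    intro k
    induction k with
    | zero => rwa [derivedSeries_zero, ← MonoidHom.range_eq_map]
    | succ k ih =>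
      rw [derivedSeries_succ, Subgroup.map_commutator]
      exact ih.commutator hz
  obtain ⟨g, hg, hg', -⟩ := key n 0 0
  rw [hn, Subgroup.map_bot, Subgroup.mem_bot] at hg
  exact hg'.ne_one hg

/-- The one-parameter unipotent subgroup with tangent direction `rankOne z z`. -/
noncomputable def linearSeries (z c : K) : PowerSeries (Matrix (Fin 2) (Fin 2) K) :=
  1 + monomial 1 (c • rankOne z z)

theorem coeff_zero_linearSeries (z c : K) : coeff 0 (linearSeries z c) = 1 := by
  rw [linearSeries, map_add, coeff_monomial, if_neg zero_ne_one, coeff_zero_one, add_zero]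

theorem linearSeries_mul (z c d : K) :
    linearSeries z c * linearSeries z d = linearSeries z (c + d) := by
  rw [linearSeries, linearSeries, linearSeries, add_mul, mul_add, mul_add, monomial_mul_monomial,
    smul_mul_smul_comm, rankOne_mul_rankOne, sub_self, zero_smul, smul_zero, map_zero, mul_one,
    one_mul, mul_one, add_zero, add_smul, map_add, add_assoc, add_comm (monomial 1 (d • _))]

theorem linearSeries_zero (z : K) : linearSeries z 0 = 1 := by
  simp [linearSeries]

theorem hasTop_linearSeries (z c : K) : HasTop (linearSeries z c) 1 (c • rankOne z z) := by
  constructor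
  · simp [linearSeries, coeff_one]
  · intro k hk
    rw [linearSeries, map_add, coeff_monomial, coeff_one, if_neg (by omega), if_neg (by omega),
      add_zero]

/-- Conjugation by the diagonal matrix moves the direction `rankOne 1 1` to a multiple of `rankOne
(Z x) (Z x)`; this is how `Z` produces new directions. -/
theorem twist_linearSeries (x : T) (c : K) :
    twist X Z x (linearSeries 1 c) = linearSeries (Z x : K) (c * (X x * (Z x)⁻¹ : Kˣ)) := by
  ext n a b
  rw [coeff_twist]
  rcases eq_or_ne n 0 with rfl | hn
  · rw [coeff_zero_linearSeries, coeff_zero_linearSeries]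
    by_cases hab : a = b
    · rw [hab, twistWeight_zero_self, one_mul]
    · rw [Matrix.one_apply_ne hab, mul_zero]
  · rw [linearSeries, linearSeries, map_add, map_add, coeff_one, if_neg hn, zero_add, zero_add,
      coeff_monomial, coeff_monomial]
    by_cases h1 : n = 1
    · rw [if_pos h1, if_pos h1, h1]
      have hZ : (Z x : K) ≠ 0 := (Z x).ne_zero
      fin_cases a <;> fin_cases b <;> simp [rankOne, twistWeight] <;> field_simp
    · rw [if_neg h1, if_neg h1, Matrix.zero_apply, mul_zero]

/-- The element of a twisted group given by `linearSeries`. -/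
noncomputable def linearElement (X Z : T →* Kˣ) (z c : K) : TwistedGroup X Z :=
  ⟨linearSeries z c, coeff_zero_linearSeries z c, 1⟩

theorem linearElement_inv (z c : K) : (linearElement X Z z c)⁻¹ = linearElement X Z z (-c) := by
  rw [_root_.inv_eq_iff_mul_eq_one]
  refine TwistedGroup.ext ?_ (one_mul 1)
  rw [TwistedGroup.mul_ser]
  change linearSeries z c * twist X Z 1 (linearSeries z (-c)) = 1
  rw [twist_one_left, linearSeries_mul, add_neg_cancel, linearSeries_zero]

theorem hasEnds_linearElement (z : K) {c : K} (hc : c ≠ 0) :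
    HasEnds (linearElement X Z z c) z z :=
  ⟨rfl, 1, one_pos, c, hc, hasTop_linearSeries z c⟩

theorem hasAllEnds_of_linearElement {z : Fin 3 → K} (hz : Function.Injective z)
    {S : Subgroup (TwistedGroup X Z)}
    (hS : ∀ i, ∃ c : K, c ≠ 0 ∧ linearElement X Z (z i) c ∈ S) : HasAllEnds z S := by
  intro i j
  obtain ⟨c, hc, hi⟩ := hS i
  obtain ⟨d, hd, hj⟩ := hS j
  have hi1 := hasEnds_linearElement (X := X) (Z := Z) (z i) hc
  have hi2 := hasEnds_linearElement (X := X) (Z := Z) (z i) (neg_ne_zero.mpr hc)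
  have hj1 := hasEnds_linearElement (X := X) (Z := Z) (z j) hd
  have hj2 := hasEnds_linearElement (X := X) (Z := Z) (z j) (neg_ne_zero.mpr hd)
  rw [← linearElement_inv] at hi2 hj2
  by_cases hij : i = j
  · subst hij
    exact ⟨_, hi, hi1, hi2⟩
  · refine ⟨_, mul_mem hi hj, hi1.mul hj1 (hz.ne hij), ?_⟩
    rw [mul_inv_rev]
    exact hj2.mul hi2 (hz.ne (Ne.symm hij))

/-- The element of a twisted group given by a torus element. -/
noncomputable def torusElement (X Z : T →* Kˣ) : T →* TwistedGroup X Z where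
  toFun x := ⟨1, by simp, x⟩
  map_one' := rfl
  map_mul' x y := TwistedGroup.ext
    (by rw [TwistedGroup.mul_ser, twist_one_right, mul_one]) rfl

theorem torusElement_conj (x : T) (c : K) :
    torusElement X Z x * linearElement X Z 1 c * (torusElement X Z x)⁻¹ =
      linearElement X Z (Z x) (c * (X x * (Z x)⁻¹ : Kˣ)) := by
  rw [mul_inv_eq_iff_eq_mul]
  refine TwistedGroup.ext ?_ ?_
  · rw [TwistedGroup.mul_ser, TwistedGroup.mul_ser]
    change 1 * twist X Z x (linearSeries 1 c) = linearSeries _ _ * twist X Z 1 1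
    rw [one_mul, twist_linearSeries, twist_one_right, mul_one]
  · change x * 1 = 1 * x
    rw [one_mul, mul_one]

/-- Conjugating one linear element by the powers `0, 1, 2` of `s` gives the directions `1`, `Z s`,
`Z s ^ 2`, which are distinct by `h1` and `h2`. -/
theorem not_isSolvable_of_mem_range {L : Type*} [Group L] (θ : L →* TwistedGroup X Z) {s : T}
    (h1 : (Z s : K) ≠ 1) (h2 : (Z s : K) ^ 2 ≠ 1) (hs : torusElement X Z s ∈ θ.range) {c : K}
    (hc : c ≠ 0) (hcθ : linearElement X Z 1 c ∈ θ.range) : ¬ Group.IsSolvable L := by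
  have h0 : (Z s : K) ≠ 0 := (Z s).ne_zero
  have hz : Function.Injective fun i : Fin 3 => (Z s : K) ^ (i : ℕ) := by
    have h3 : (Z s : K) ^ 2 ≠ Z s := by
      intro h
      rw [sq] at h
      exact h1 (mul_eq_left₀ h0 |>.mp h)
    intro i j hij
    fin_cases i <;> fin_cases j <;> simp_all [eq_comm]
  refine not_isSolvable_of_hasAllEnds hz θ (hasAllEnds_of_linearElement hz fun i => ?_)
  refine ⟨c * (X (s ^ (i : ℕ)) * (Z (s ^ (i : ℕ)))⁻¹ : Kˣ), mul_ne_zero hc (Units.ne_zero _), ?_⟩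
  have hsi : torusElement X Z (s ^ (i : ℕ)) ∈ θ.range := by
    rw [map_pow]
    exact pow_mem hs _
  have := mul_mem (mul_mem hsi hcθ) (inv_mem hsi)
  rw [torusElement_conj] at this
  simpa only [map_pow, Units.val_pow_eq_pow_val] using this

end Insoluble

/-! ### Insolubility of the localization and infinite cyclic quotients. -/

section Main

variable {π : Set ℕ}

/-- The localization of a group that maps onto a finitely generated metabelian group with unique
roots is insoluble unless the latter is virtually nilpotent. -/
theorem IsLocalization.not_isSolvable {G L Q : Type u} [Group G] [Group L] [Group Q]
    (hπ : π.Finite) {l : G →* L} (hl : IsLocalization π l) (f : G →* Q)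
    (hf : Function.Surjective f) (hfg : Group.FG Q) (hmet : derivedSeries Q 2 = ⊥) (hU : IsU π Q)
    (hnv : ¬ Group.IsVirtuallyNilpotent Q) : ¬ Group.IsSolvable L := by
  have hcomm : IsMulCommutative (commutator Q) := by
    rwa [derivedSeries_succ, derivedSeries_one, Subgroup.commutator_self_eq_bot_iff] at hmet
  obtain ⟨K, _, _, χ, φ, hφ, ⟨a, ha⟩, hinf, hχ⟩ := exists_affine_character hfg hU hnv
  obtain ⟨T, _, τ, X, Z, t, s, q, hT, hXτ, hZτ, hq, hqπ, hst, ht, hZ1, hZ2, hw⟩ :=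
    exists_torus hπ hfg χ hinf hχ
  have hmem : ∀ g h : Q, ⁅g, h⁆ ∈ commutator Q := fun g h =>
    Subgroup.commutator_mem_commutator (Subgroup.mem_top _) (Subgroup.mem_top _)
  -- This crossed homomorphism is the translation part of the affine representation, normalized so
  -- that `t` fixes the origin and maps into the torus.
  let δ : Q → K := fun g => φ (Additive.ofMul ⟨⁅g, t⁆, hmem g t⟩)
  have hδ : ∀ g h, δ (g * h) = δ g + χ g * δ h := by
    intro g h
    change φ _ = φ _ + χ g * φ _
    rw [← hφ, ← map_add]
    congr 1
    apply Additive.toMul.injective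
    rw [toMul_add, mul_comm]
    apply Subtype.ext
    change ⁅g * h, t⁆ = g * ⁅h, t⁆ * g⁻¹ * ⁅g, t⁆
    simp only [commutatorElement_def]
    group
  have hδt : δ t = 0 := by
    have : (Additive.ofMul ⟨⁅t, t⁆, hmem t t⟩ : Additive (commutator Q)) = 0 := by
      apply Additive.toMul.injective
      exact Subtype.ext (commutatorElement_self t)
    change φ _ = 0
    rw [this, map_zero]
  have hδa : δ (a.toMul : Q) = (1 - χ t) * φ a := by
    rw [sub_mul, one_mul, ← hφ, ← map_sub]
    change φ _ = _
    congr 1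
    rw [sub_eq_add_neg]
    apply Additive.toMul.injective
    apply Subtype.ext
    change ⁅(a.toMul : Q), t⁆ = a.toMul * (t * (a.toMul : Q) * t⁻¹)⁻¹
    rw [commutatorElement_def]
    group
  have hχa : τ (a.toMul : Q) = 1 := by
    have : commutator Q ≤ τ.ker := Abelianization.commutator_subset_ker τ
    exact this a.toMul.2
  -- Since `Z` is trivial on the image of `τ`, twisting keeps the direction `1` and only scales by
  -- `χ`; the cocycle identity `hδ` then gives a homomorphism.
  let Θ : Q →* TwistedGroup X Z := MonoidHom.mk'
    (fun g => ⟨linearSeries 1 (δ g), coeff_zero_linearSeries _ _, τ g⟩) (by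
      intro g h
      refine TwistedGroup.ext ?_ (map_mul τ g h)
      change linearSeries 1 (δ (g * h)) =
        linearSeries 1 (δ g) * twist X Z (τ g) (linearSeries 1 (δ h))
      rw [twist_linearSeries, hZτ, inv_one, mul_one, hXτ, Units.val_one, linearSeries_mul, hδ,
        mul_comm (χ g)])
  have hloc : IsLocal π (TwistedGroup X Z) := TwistedGroup.isLocal hT hw
  obtain ⟨θ, hθ, -⟩ := hl.existsUnique_lift _ hloc (Θ.comp f)
  have hθf : ∀ g, θ (l g) = Θ (f g) := fun g => DFunLike.congr_fun hθ g
  refine not_isSolvable_of_mem_range θ hZ1 hZ2 (s := s) ?_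
    (c := δ (a.toMul : Q)) ?_ ?_
  -- The `q`-th root taken in `L` maps to a `q`-th root of the torus element of `τ t`; by uniqueness
  -- this is the torus element of `s`.
  · obtain ⟨g, hg⟩ := hf t
    obtain ⟨y, hy⟩ := (hl.isLocal q hq hqπ).2 (l g)
    refine ⟨y, (hloc q hq hqπ).1 ?_⟩
    change θ y ^ q = torusElement X Z s ^ q
    rw [← map_pow, ← map_pow, hst, show y ^ q = l g from hy, hθf, hg]
    refine TwistedGroup.ext ?_ rfl
    change linearSeries 1 (δ t) = 1
    rw [hδt, linearSeries_zero]
  · rw [hδa]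
    exact mul_ne_zero (sub_ne_zero.mpr ht.symm) ha
  · obtain ⟨g, hg⟩ := hf (a.toMul : Q)
    refine ⟨l g, ?_⟩
    rw [hθf, hg]
    exact TwistedGroup.ext rfl hχa

theorem IsLocal.isU {S : Type u} [Group S] (hS : IsLocal π S) : IsU π S := by
  rintro m ⟨hm, hmp⟩
  induction m using Nat.recOnMul with
  | zero => exact absurd hm (lt_irrefl 0)
  | one =>
    intro x y h
    simpa using h
  | prime p hp => exact (hS p hp (hmp p hp dvd_rfl)).1
  | mul a b iha ihb =>
    intro x y h
    simp only [pow_mul] at h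
    exact iha (Nat.pos_of_mul_pos_right hm) (fun p hp hd => hmp p hp (hd.mul_right b))
      (ihb (Nat.pos_of_mul_pos_left hm) (fun p hp hd => hmp p hp (hd.mul_left a)) h)

theorem derivedSeries_eq_bot_of_surjective {G Q : Type*} [Group G] [Group Q] {f : G →* Q}
    (hf : Function.Surjective f) {n : ℕ} (h : derivedSeries G n = ⊥) : derivedSeries Q n = ⊥ := by
  rw [← map_derivedSeries_eq hf, h, Subgroup.map_bot]

/-- In an abelian group every centralizer is the whole group, and so is `dSet`; alternative (a) of
the class holds. -/
theorem isP_of_mulEquiv_int (π : Set ℕ) {Q : Type u} [Group Q] (e : Q ≃* Multiplicative ℤ) :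
    IsP π Q := by
  have hcomm : ∀ x y : Q, x * y = y * x := fun x y => e.injective (by
    rw [map_mul, map_mul, mul_comm])
  have hinj : ∀ m : ℕ, 0 < m → Function.Injective fun x : Q => x ^ m := by
    intro m hm x y h
    apply e.injective
    apply Multiplicative.toAdd.injective
    have := congrArg (fun x => (e x).toAdd) h
    simp only [map_pow, toAdd_pow, nsmul_eq_mul] at this
    exact mul_left_cancel₀ (by exact_mod_cast hm.ne') this
  have hcent : ∀ x : Q, cent x = ⊤ := fun x => top_le_iff.mp fun y _ =>
    Subgroup.mem_centralizer_singleton_iff.mpr (hcomm _ _)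
  refine ⟨fun m hm => hinj m hm.1, fun x _ => ⟨?_, Or.inl ?_⟩⟩
  · intro c _ hc
    obtain ⟨n, hn, h⟩ := isOfFinOrder_iff_pow_eq_one.mp hc
    exact hinj n hn (by simpa using h)
  · ext g
    rw [hcent, Subgroup.coe_top]
    refine ⟨fun _ => trivial, fun _ => ?_⟩
    change cent x ⊓ conjSubgroup (cent x) g ≠ ⊥
    rw [hcent, conjSubgroup, Subgroup.map_top_of_surjective _ (MulAut.conj g⁻¹).surjective,
      top_inf_eq]
    intro h
    have h1 : e.symm (Multiplicative.ofAdd 1) ∈ (⊤ : Subgroup Q) := Subgroup.mem_top _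
    rw [h, Subgroup.mem_bot, EmbeddingLike.map_eq_one_iff] at h1
    exact absurd (congrArg Multiplicative.toAdd h1) one_ne_zero

theorem not_isLocal_of_mulEquiv_int (hπ : π.Finite) {Q : Type u} [Group Q]
    (e : Q ≃* Multiplicative ℤ) : ¬ IsLocal π Q := by
  intro h
  obtain ⟨q, hq, hqπ, h3⟩ := exists_odd_prime_notMem hπ
  obtain ⟨y, hy⟩ := (h q hq hqπ).2 (e.symm (Multiplicative.ofAdd 1))
  have h1 := congrArg (fun x => (e x).toAdd) hy
  simp only [map_pow, toAdd_pow, nsmul_eq_mul, MulEquiv.apply_symm_apply, toAdd_ofAdd] at h1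
  have := Int.eq_one_or_neg_one_of_mul_eq_one h1
  omega

/-- A finitely generated group with finite abelianization and commutative derived group is virtually
nilpotent; otherwise, it has an infinite cyclic quotient. -/
theorem isVirtuallyNilpotent_or_exists_quotient_int {G : Type u} [Group G] (hfg : Group.FG G)
    (hmet : derivedSeries G 2 = ⊥) : Group.IsVirtuallyNilpotent G ∨
      ∃ N : Subgroup G, ∃ _ : N.Normal, Nonempty (G ⧸ N ≃* Multiplicative ℤ) := by
  have hcomm : IsMulCommutative (commutator G) := by
    rwa [derivedSeries_succ, derivedSeries_one, Subgroup.commutator_self_eq_bot_iff] at hmet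
  have : Group.FG (Abelianization G) :=
    Group.fg_of_surjective (f := Abelianization.of) QuotientGroup.mk_surjective
  obtain ⟨ι, j, hι, hj, p, hp, e, ⟨E⟩⟩ :=
    CommGroup.equiv_free_prod_prod_multiplicative_zmod (Abelianization G)
  rcases isEmpty_or_nonempty j with hempty | ⟨⟨j0⟩⟩
  · left
    have hne : ∀ i, NeZero (p i ^ e i) := fun i => ⟨pow_ne_zero _ (hp i).ne_zero⟩
    have : ∀ i, Finite (Multiplicative (ZMod (p i ^ e i))) := fun i =>
      inferInstanceAs (Finite (ZMod (p i ^ e i)))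
    have hfin : Finite (Abelianization G) := Finite.of_equiv _ E.symm.toEquiv
    have : Finite (G ⧸ commutator G) := hfin
    exact ⟨commutator G, CommGroup.isNilpotent, Subgroup.finiteIndex_of_finite_quotient⟩
  · right
    let f : G →* Multiplicative ℤ := (Pi.evalMonoidHom _ j0).comp ((MonoidHom.fst _ _).comp
      (E.toMonoidHom.comp Abelianization.of))
    have hf : Function.Surjective f :=
      (Function.surjective_eval j0).comp (Prod.fst_surjective.comp
        (E.surjective.comp QuotientGroup.mk_surjective))
    exact ⟨f.ker, inferInstance, ⟨QuotientGroup.quotientKerEquivOfSurjective f hf⟩⟩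

theorem isVirtuallyNilpotent_of_surjective {G Q : Type u} [Group G] [Group Q] {f : G →* Q}
    (hf : Function.Surjective f) (h : Group.IsVirtuallyNilpotent G) :
    Group.IsVirtuallyNilpotent Q := by
  obtain ⟨N, hN, hfin⟩ := h
  refine ⟨N.map f, Group.nilpotent_of_surjective (f.subgroupMap N)
    (f.subgroupMap_surjective N), ⟨fun h => ?_⟩⟩
  exact hfin.index_ne_zero (Nat.eq_zero_of_zero_dvd (h ▸ N.index_map_dvd hf))

end Main

end PiGroup

theorem corollary3p2 {G L : Type u} [Group G] [Group L] (hfg : Group.FG G)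
    (hmet : derivedSeries G 2 = ⊥) (π : Set ℕ) (hπ : π.Finite) (hprime : ∀ p ∈ π, p.Prime)
    (l : G →* L) (hl : PiGroup.IsLocalization π l) :
    (((∃ N : Subgroup G, ∃ _ : N.Normal, PiGroup.IsP π (G ⧸ N) ∧ ¬ PiGroup.IsLocal π (G ⧸ N)) ∧
        ¬ Group.IsSolvable L) ∨
      Group.IsVirtuallyNilpotent L) ∧
    (∀ N : Subgroup G, ∀ _ : N.Normal, PiGroup.IsP π (G ⧸ N) →
      ¬ Group.IsVirtuallyNilpotent (G ⧸ N) → ¬ Group.IsSolvable L) := by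
  refine ⟨or_iff_not_imp_right.mpr fun hL => ?_, fun N _ hN hnv => ?_⟩
  · have hrange : ¬ Group.IsVirtuallyNilpotent l.range := mt hl.isVirtuallyNilpotent hL
    have hsurj := l.rangeRestrict_surjective
    -- Uniqueness of roots passes to subgroups of `L`, although their existence does not.
    have hU : PiGroup.IsU π l.range := fun m hm x y h => by
      apply Subtype.ext
      apply hl.isLocal.isU m hm
      simpa using congrArg Subtype.val h
    refine ⟨?_, hl.not_isSolvable hπ l.rangeRestrict hsurj (Group.fg_of_surjective hsurj)
      (PiGroup.derivedSeries_eq_bot_of_surjective hsurj hmet) hU hrange⟩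
    rcases PiGroup.isVirtuallyNilpotent_or_exists_quotient_int hfg hmet with h | ⟨N, hN, ⟨e⟩⟩
    · exact absurd (PiGroup.isVirtuallyNilpotent_of_surjective hsurj h) hrange
    · exact ⟨N, hN, PiGroup.isP_of_mulEquiv_int π e, PiGroup.not_isLocal_of_mulEquiv_int hπ e⟩
  · have hsurj := QuotientGroup.mk'_surjective N
    exact hl.not_isSolvable hπ (QuotientGroup.mk' N) hsurj (Group.fg_of_surjective hsurj)
      (PiGroup.derivedSeries_eq_bot_of_surjective hsurj hmet) hN.1 hnv
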